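/- Let $a,b\in\mathbb{R}$ with $a<b$ and $\Omega=(a,b)$. The finite Hilbert transformation $$(A_\Omega u)(x)=\frac1{i\pi}\,\mathrm{p.v.}\!\int_\Omega\frac{u(y)}{x-y}\,dy=\lim_{\varepsilon\to0^+}\frac1{i\pi}\int_{y\in\Omega,\,|x-y|>\varepsilon}\frac{u(y)}{x-y}\,dy\qquad\text{for a.e. }x\in\Omega$$ exists for every complex-valued $u\in L^2(\Omega)$ and defines a bounded linear operator $A_\Omega$ on $L^2(\Omega)$. For every integer $N\ge1$ fix an arbitrary origin $a^N\in\mathbb{R}$, and set $x^N_m=a^N+\frac mN$ for $m\in\mathbb{Z}$ and $\omega^N=\{m\in\mathbb{Z}\mid x^N_m\in\Omega\}$. The delta-delta discretization of the equation $(\lambda\,\mathrm{Id}-A_\Omega)u=f$ is the linear system $$\lambda u_m-\frac1{i\pi N}\sum_{n\in\omega^N,\,n\ne m}\frac{u_n}{x^N_m-x^N_n}=f(x^N_m)\qquad(m\in\omega^N),$$ whose matrix is $\lambda\,\mathrm{Id}-T^N$, where $T^N$ has the entries $\frac1{i\pi N}\,\frac1{x^N_m-x^N_n}$ for $m\neq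 n$ and zeros on the diagonal ($m,n\in\omega^N$). The method is called stable in the $\ell^2$ norm if $\lambda\,\mathrm{Id}-T^N$ is invertible for all $N\ge1$ and the operator norms $\|(\lambda\,\mathrm{Id}-T^N)^{-1}\|_{\mathcal L(\ell^2(\omega^N))}$ are bounded by a constant that does not depend on $N$. Then for every $\lambda\in\mathbb{C}$ the following are equivalent: (i) For every $f\in L^2(\Omega)$ the singular integral equation $$\lambda u(x)-\frac1{i\pi}\,\mathrm{p.v.}\!\int_\Omega\frac{u(y)}{x-y}\,dy=f(x)\qquad\text{for a.e. }x\in\Omega$$ has a unique solution $u\in L^2(\Omega)$. (ii) The delta-delta discretization is stable in the $\ell^2$ norm. (iii) $\lambda\notin[-1,1]$. For such $\lambda$, the operators $\lambda\,\mathrm{Id}-A_\Omega$ and $\lambda\,\mathrm{Id}-T^N$ are boundedly invertible, and for all $N\ge1$ $$\|(\lambda\,\mathrm{Id}-T^N)^{-1}\|_{\mathcal L(\ell^2(\omega^N))}\le\|(\lambda\,\mathrm{Id}-A_\Omega)^{-1}\|_{\mathcal L(L^2(\Omega))}.$$ -/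

import Mathlib

open MeasureTheory Filter Topology

noncomputable section

namespace FiniteHilbert

/-- The complex Hilbert space `L²(Ω)`, `Ω = (a, b)`, with Lebesgue measure. -/
abbrev L2 (a b : ℝ) : Type := Lp ℂ 2 (volume.restrict (Set.Ioo a b))

/-- The truncated integral `(1 / (iπ)) ∫_{y ∈ Ω, |x - y| > ε} u(y) / (x - y) dy`, `Ω = (a, b)`. -/
def truncatedIntegral (a b : ℝ) (u : ℝ → ℂ) (ε x : ℝ) : ℂ :=
  1 / (Complex.I * Real.pi) *
    ∫ y in Set.Ioo a b ∩ {y : ℝ | ε < |x - y|}, u y / ((x : ℂ) - (y : ℂ))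

/-- The Cauchy principal value `(1 / (iπ)) p.v. ∫_Ω u(y) / (x - y) dy` at the point `x`
exists and equals `l`. -/
def HasPrincipalValue (a b : ℝ) (u : ℝ → ℂ) (x : ℝ) (l : ℂ) : Prop :=
  Tendsto (fun ε : ℝ => truncatedIntegral a b u ε x) (𝓝[>] 0) (𝓝 l)

/-- `u` solves `lam u(x) - (1 / (iπ)) p.v. ∫_Ω u(y) / (x - y) dy = f(x)` for almost every
`x ∈ Ω = (a, b)`; the existence of the principal value almost everywhere is included. -/
def SolvesSIE (a b : ℝ) (lam : ℂ) (u f : L2 a b) : Prop :=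
  ∀ᵐ x ∂(volume.restrict (Set.Ioo a b)),
    ∃ l : ℂ, HasPrincipalValue a b u x l ∧ lam * u x - l = f x

/-- For every `f ∈ L²(Ω)` the singular integral equation has a unique solution in `L²(Ω)`. -/
def UniquelySolvable (a b : ℝ) (lam : ℂ) : Prop :=
  ∀ f : L2 a b, ∃! u : L2 a b, SolvesSIE a b lam u f

/-- The bounded operator `A` on `L²(Ω)` is the finite Hilbert transformation `A_Ω`:
for every `u`, the principal value exists and equals `(A u)(x)` for almost every `x ∈ Ω`. -/
def IsFiniteHilbertTransform (a b : ℝ) (A : L2 a b →L[ℂ] L2 a b) : Prop :=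
  ∀ u : L2 a b, ∀ᵐ x ∂(volume.restrict (Set.Ioo a b)), HasPrincipalValue a b u x (A u x)

/-- There is at most one finite Hilbert transformation, so that one may speak of "the" one. -/
theorem IsFiniteHilbertTransform.unique {a b : ℝ} {A B : L2 a b →L[ℂ] L2 a b}
    (hA : IsFiniteHilbertTransform a b A) (hB : IsFiniteHilbertTransform a b B) : A = B := by
  ext u
  filter_upwards [hA u, hB u] with x h1 h2
  exact tendsto_nhds_unique h1 h2

/-- The grid point `x_m = o + m / N` of the regular grid with origin `o` and meshwidth `1 / N`. -/
def gridPoint (o : ℝ) (N : ℕ+) (m : ℤ) : ℝ := o + (m : ℝ) / (N : ℕ)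

/-- The index set `ω = {m ∈ ℤ | x_m ∈ Ω}`, `Ω = (a, b)`. -/
def gridIndex (a b o : ℝ) (N : ℕ+) : Set ℤ := {m : ℤ | gridPoint o N m ∈ Set.Ioo a b}

theorem gridIndex_finite (a b o : ℝ) (N : ℕ+) : (gridIndex a b o N).Finite := by
  have hN : (0 : ℝ) < (N : ℕ) := by exact_mod_cast N.pos
  refine (Set.finite_Icc ⌊(a - o) * (N : ℕ)⌋ ⌈(b - o) * (N : ℕ)⌉).subset ?_
  rintro m ⟨h1, h2⟩
  unfold gridPoint at h1 h2
  have h1' : (a - o) * (N : ℕ) < m := by rw [← lt_div_iff₀ hN]; linarith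
  have h2' : (m : ℝ) < (b - o) * (N : ℕ) := by rw [← div_lt_iff₀ hN]; linarith
  constructor
  · exact_mod_cast ((Int.floor_le _).trans h1'.le)
  · exact_mod_cast (h2'.le.trans (Int.le_ceil _))

instance gridIndexFintype (a b o : ℝ) (N : ℕ+) : Fintype (gridIndex a b o N) :=
  (gridIndex_finite a b o N).fintype

/-- The system matrix of the delta-delta discretization, with entries
`1 / (iπN) * 1 / (x_m - x_n)` for `m ≠ n` and zero on the diagonal, `m, n ∈ ω`. -/
def systemMatrix (a b o : ℝ) (N : ℕ+) :
    Matrix (gridIndex a b o N) (gridIndex a b o N) ℂ :=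
  Matrix.of fun m n =>
    if m = n then 0
    else 1 / (Complex.I * Real.pi * (N : ℕ)) *
      (1 / ((gridPoint o N m : ℂ) - (gridPoint o N n : ℂ)))

/-- The discretized operator `T^N` on `ℓ²(ω)`: multiplication by the system matrix. -/
def discreteOp (a b o : ℝ) (N : ℕ+) :
    EuclideanSpace ℂ (gridIndex a b o N) →L[ℂ] EuclideanSpace ℂ (gridIndex a b o N) :=
  Matrix.toEuclideanCLM (n := gridIndex a b o N) (𝕜 := ℂ) (systemMatrix a b o N)

/-- The method `(lam - T^N) U = F` is stable in the `ℓ²` norm: for all `N` the operator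
`lam - T^N` is invertible, and the `ℓ²` operator norms of the inverses are bounded uniformly
in `N`. Here `o N` is the origin of the grid with meshwidth `1 / N`. -/
def IsStable (a b : ℝ) (o : ℕ+ → ℝ) (lam : ℂ) : Prop :=
  ∃ C : ℝ, ∀ N : ℕ+, IsUnit (lam • 1 - discreteOp a b (o N) N) ∧
    ‖Ring.inverse (lam • 1 - discreteOp a b (o N) N)‖ ≤ C

/-- The segment `[-1, 1]` of the real axis, as a subset of the complex plane. -/
def segmentC : Set ℂ := (fun t : ℝ => (t : ℂ)) '' Set.Icc (-1) 1

end FiniteHilbert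

end

/-! Both operators are compressions of multiplication by a real symbol of modulus at most 1, hence
self-adjoint contractions. On the line the symbol is `-sgn` on the Fourier side, and `finiteH` is
its compression to functions supported in `Ω`. On the circle it is the sawtooth `1 - 2θ` on `(0,
1]`, whose Fourier coefficients are the matrix entries `1 / (iπ(m - n))`; `T^N` is its compression
to the trigonometric polynomials with frequencies in `ω^N`. Therefore `lam - T` is invertible for
`lam` off `[-1, 1]`, and it is bounded below by the distance `d` of `lam` to `[-1, 1]`
(`isUnit_smul_one_sub`, `exists_dist_mul_norm_le`). This gives stability with `‖(lam - T^N)⁻¹‖ ≤ 1 /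
d`.

Conversely, each point of `[-1, 1]` is an approximate eigenvalue of `A_Ω`, and of the family `T^N`.
For `A_Ω` the test functions are `((y - a) / (b - y)) ^ γ`: Cauchy integrals of these are explicit,
and `A_Ω` maps such a function to `-i cot(πγ)` times itself plus a constant. As `Re γ` decreases to
`-1/2` the `L²` norm blows up while the constant stays bounded
(`exists_approx_eigenvector_finiteH`). For `T^N` the test vectors are plane waves: their
trigonometric polynomial is a Dirichlet kernel concentrated where the sawtooth equals `lam`, and its
product with `lam - sawtooth` stays bounded while its norm grows like `√N`
(`exists_approx_eigenvector_discreteOp`).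

The approximate eigenvectors of `A_Ω` at the point of `[-1, 1]` nearest to `lam` also give `‖(lam -
A_Ω)⁻¹‖ ≥ 1 / d`, hence the comparison of the resolvents; no convergence of `T^N` to `A_Ω` is used.

It remains to identify the Fourier multiplier with the principal value
(`isFiniteHilbertTransform_finiteH`). Cauchy kernels are Fourier transforms of one-sided
exponentials, so the conjugate Poisson integral of `u` is `i` times the Poisson integral of `lineH
u`, which converges almost everywhere; the truncated kernel differs from the conjugate Poisson
kernel by an odd kernel dominated by the Poisson kernel. -/

noncomputable section

namespace FiniteHilbert

open scoped ENNReal FourierTransform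

/-! ### Multiplication operators on `L²`. -/

section Multiplication

variable {α : Type*} {m : MeasurableSpace α} {μ : Measure α}

/-- Multiplication by a bounded function, as an operator on `L²`. -/
def mulOp (f : α → ℂ) (hf : MemLp f ∞ μ) : Lp ℂ 2 μ →L[ℂ] Lp ℂ 2 μ :=
  (ContinuousLinearMap.mul ℂ ℂ).holderL μ ∞ 2 2 (hf.toLp f)

theorem coeFn_mulOp (f : α → ℂ) (hf : MemLp f ∞ μ) (u : Lp ℂ 2 μ) :
    mulOp f hf u =ᵐ[μ] fun x => f x * u x := by
  filter_upwards [(ContinuousLinearMap.mul ℂ ℂ).coeFn_holder (r := 2) (hf.toLp f) u,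
    hf.coeFn_toLp] with x h1 h2
  simp only [mulOp, ContinuousLinearMap.holderL_apply_apply]
  rw [h1, h2]
  rfl

theorem norm_mulOp_le (f : α → ℂ) (hf : MemLp f ∞ μ) (h1 : ∀ x, ‖f x‖ ≤ 1) (u : Lp ℂ 2 μ) :
    ‖mulOp f hf u‖ ≤ ‖u‖ := by
  refine Lp.norm_le_norm_of_ae_le ?_
  filter_upwards [coeFn_mulOp f hf u] with x hx
  rw [hx, norm_mul]
  exact mul_le_of_le_one_left (norm_nonneg _) (h1 x)

theorem inner_mulOp_left (f : α → ℂ) (hf : MemLp f ∞ μ) (h1 : ∀ x, starRingEnd ℂ (f x) = f x)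
    (u v : Lp ℂ 2 μ) : inner ℂ (mulOp f hf u) v = inner ℂ u (mulOp f hf v) := by
  rw [L2.inner_def, L2.inner_def]
  refine integral_congr_ae ?_
  filter_upwards [coeFn_mulOp f hf u, coeFn_mulOp f hf v] with x hu hv
  rw [hu, hv]
  simp only [RCLike.inner_apply, map_mul, h1]
  ring

end Multiplication

/-! ### The Fourier transform moved across the bilinear pairing. -/

section FourierPairing

/-- The bilinear pairing on `L²` is continuous. -/
theorem continuous_integral_mul {α : Type*} {m : MeasurableSpace α} {μ : Measure α} {w : α → ℂ}
    (hw : MemLp w 2 μ) :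
    Continuous fun h : Lp ℂ 2 μ => ∫ x, w x * h x ∂μ := by
  have h1 : (fun h : Lp ℂ 2 μ => ∫ x, w x * h x ∂μ) =
      fun h => (ContinuousLinearMap.mul ℂ ℂ).lpPairing μ 2 2 (hw.toLp w) h := by
    funext h
    rw [ContinuousLinearMap.lpPairing_eq_integral]
    refine integral_congr_ae ?_
    filter_upwards [hw.coeFn_toLp] with x hx
    simp [hx]
  rw [h1]
  fun_prop

/-- Both sides are continuous in `h`, so it suffices to take `h` Schwartz, where this is Fubini. It
links the pointwise integral `𝓕 g` with the Plancherel extension applied to `h`. -/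
theorem integral_fourier_mul_eq_integral_mul_fourier {g : ℝ → ℂ} (hg1 : Integrable g)
    (hg2 : MemLp g 2) (hG : MemLp (𝓕 g) 2) (h : Lp ℂ 2 (volume : Measure ℝ)) :
    ∫ x, 𝓕 g x * h x = ∫ x, g x * (𝓕 h : Lp ℂ 2 (volume : Measure ℝ)) x := by
  refine DenseRange.induction_on
    (p := fun h : Lp ℂ 2 (volume : Measure ℝ) =>
      ∫ x, 𝓕 g x * h x = ∫ x, g x * (𝓕 h : Lp ℂ 2 (volume : Measure ℝ)) x)
    (SchwartzMap.denseRange_toLpCLM (p := 2) ENNReal.ofNat_ne_top) h ?_ ?_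
  · exact isClosed_eq (continuous_integral_mul hG)
      ((continuous_integral_mul hg2).comp (Lp.fourierTransformₗᵢ ℝ ℂ).continuous)
  · intro φ
    simp only [SchwartzMap.toLpCLM_apply]
    rw [SchwartzMap.toLp_fourier_eq]
    have h1 : ∫ x, 𝓕 g x * (φ.toLp 2 : Lp ℂ 2 (volume : Measure ℝ)) x = ∫ x, 𝓕 g x * φ x := by
      refine integral_congr_ae ?_
      filter_upwards [φ.coeFn_toLp 2 volume] with x hx
      rw [hx]
    have h2 : ∫ x, g x * ((𝓕 φ).toLp 2 : Lp ℂ 2 (volume : Measure ℝ)) x = ∫ x, g x * 𝓕 φ x := by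
      refine integral_congr_ae ?_
      filter_upwards [(𝓕 φ).coeFn_toLp 2 volume] with x hx
      rw [hx]
    rw [h1, h2]
    have := VectorFourier.integral_fourierIntegral_smul_eq_flip (e := Real.fourierChar)
      (μ := volume) (ν := volume) (L := innerₗ ℝ) (f := g) (g := φ)
      Real.continuous_fourierChar continuous_inner hg1 φ.integrable
    simp only [flip_innerₗ, smul_eq_mul] at this
    rw [SchwartzMap.fourier_coe]
    exact this

end FourierPairing

/-! ### The Hilbert transformation on the line and Cauchy kernels. -/

section LineHilbertTransform

/-- The symbol `-sgn` of the Hilbert transformation on the line. -/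
def symbolH (ξ : ℝ) : ℂ := if 0 < ξ then -1 else 1

theorem norm_symbolH_le (ξ : ℝ) : ‖symbolH ξ‖ ≤ 1 := by
  unfold symbolH; split_ifs <;> simp

theorem memLp_symbolH : MemLp symbolH ∞ (volume : Measure ℝ) := by
  refine memLp_top_of_bound (Measurable.aestronglyMeasurable ?_) 1
    (Eventually.of_forall norm_symbolH_le)
  exact Measurable.ite measurableSet_Ioi measurable_const measurable_const

/-- The Hilbert transformation on `L²(ℝ)`, defined as a Fourier multiplier. -/
def lineH : Lp ℂ 2 (volume : Measure ℝ) →L[ℂ] Lp ℂ 2 (volume : Measure ℝ) :=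
  ((Lp.fourierTransformₗᵢ ℝ ℂ).symm.toContinuousLinearEquiv :
      Lp ℂ 2 (volume : Measure ℝ) →L[ℂ] Lp ℂ 2 (volume : Measure ℝ)) ∘L
    mulOp symbolH memLp_symbolH ∘L
    ((Lp.fourierTransformₗᵢ ℝ ℂ).toContinuousLinearEquiv :
      Lp ℂ 2 (volume : Measure ℝ) →L[ℂ] Lp ℂ 2 (volume : Measure ℝ))

theorem lineH_apply (u : Lp ℂ 2 (volume : Measure ℝ)) :
    lineH u = (Lp.fourierTransformₗᵢ ℝ ℂ).symm
      (mulOp symbolH memLp_symbolH (Lp.fourierTransformₗᵢ ℝ ℂ u)) := rfl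

theorem fourier_lineH (u : Lp ℂ 2 (volume : Measure ℝ)) :
    (𝓕 (lineH u) : Lp ℂ 2 (volume : Measure ℝ)) = mulOp symbolH memLp_symbolH (𝓕 u) := by
  rw [lineH_apply]
  exact (Lp.fourierTransformₗᵢ ℝ ℂ).apply_symm_apply _

theorem norm_lineH_le (u : Lp ℂ 2 (volume : Measure ℝ)) : ‖lineH u‖ ≤ ‖u‖ := by
  rw [lineH_apply, LinearIsometryEquiv.norm_map]
  refine (norm_mulOp_le _ _ norm_symbolH_le _).trans ?_
  rw [LinearIsometryEquiv.norm_map]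

theorem inner_lineH_left (u v : Lp ℂ 2 (volume : Measure ℝ)) :
    inner ℂ (lineH u) v = inner ℂ u (lineH v) := by
  rw [← LinearIsometryEquiv.inner_map_map (Lp.fourierTransformₗᵢ ℝ ℂ) (lineH u) v,
    ← LinearIsometryEquiv.inner_map_map (Lp.fourierTransformₗᵢ ℝ ℂ) u (lineH v)]
  simp only [lineH_apply, LinearIsometryEquiv.apply_symm_apply]
  refine inner_mulOp_left _ _ (fun x => ?_) _ _
  unfold symbolH; split_ifs <;> simp

/-- If `g` is supported where the symbol is the constant `c`, the transformation acts on the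
pairing with `𝓕 g` as multiplication by `c`. -/
theorem integral_fourier_mul_lineH {g : ℝ → ℂ} {c : ℂ} (hg1 : Integrable g)
    (hg2 : MemLp g 2) (hG : MemLp (𝓕 g) 2) (hc : ∀ ξ, g ξ * symbolH ξ = c * g ξ)
    (u : Lp ℂ 2 (volume : Measure ℝ)) :
    ∫ x, 𝓕 g x * lineH u x = c * ∫ x, 𝓕 g x * u x := by
  rw [integral_fourier_mul_eq_integral_mul_fourier hg1 hg2 hG,
    integral_fourier_mul_eq_integral_mul_fourier hg1 hg2 hG, fourier_lineH,
    ← integral_const_mul]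
  refine integral_congr_ae ?_
  filter_upwards [coeFn_mulOp symbolH memLp_symbolH (𝓕 u)] with x hx
  rw [hx, ← mul_assoc, hc, mul_assoc]

/-- The function with Fourier transform `y ↦ i / (2π (x - y + iε))`. -/
def upperExp (x ε ξ : ℝ) : ℂ :=
  (Set.Ioi (0 : ℝ)).indicator (fun ξ : ℝ => Complex.exp ((2 * Real.pi * (Complex.I * x - ε)) * ξ)) ξ

/-- The function with Fourier transform `y ↦ -i / (2π (x - y - iε))`. -/
def lowerExp (x ε ξ : ℝ) : ℂ :=
  (Set.Iic (0 : ℝ)).indicator (fun ξ : ℝ => Complex.exp ((2 * Real.pi * (Complex.I * x + ε)) * ξ)) ξ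

theorem memLp_two_of_sq {f : ℝ → ℂ} (hf : AEStronglyMeasurable f volume) {g : ℝ → ℝ}
    (hg : Integrable g) (h : ∀ x, ‖f x‖ ^ 2 = g x) : MemLp f 2 volume := by
  rw [memLp_two_iff_integrable_sq_norm hf]
  simpa only [h] using hg

theorem integrable_upperExp (x : ℝ) {ε : ℝ} (hε : 0 < ε) : Integrable (upperExp x ε) := by
  have : Integrable ((Set.Ioi (0 : ℝ)).indicator (fun ξ : ℝ =>
      Complex.exp ((2 * Real.pi * (Complex.I * x - ε)) * ξ))) := by
    rw [integrable_indicator_iff measurableSet_Ioi]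
    refine integrableOn_exp_mul_complex_Ioi ?_ 0
    have := Real.pi_pos
    simp; positivity
  exact this

theorem integrable_lowerExp (x : ℝ) {ε : ℝ} (hε : 0 < ε) : Integrable (lowerExp x ε) := by
  have : Integrable ((Set.Iic (0 : ℝ)).indicator (fun ξ : ℝ =>
      Complex.exp ((2 * Real.pi * (Complex.I * x + ε)) * ξ))) := by
    rw [integrable_indicator_iff measurableSet_Iic]
    refine integrableOn_exp_mul_complex_Iic ?_ 0
    have := Real.pi_pos
    simp; positivity
  exact this

/-- The squared modulus is again a one-sided exponential, with `x = 0` and `2ε` for `ε`. -/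
theorem memLp_upperExp (x : ℝ) {ε : ℝ} (hε : 0 < ε) : MemLp (upperExp x ε) 2 := by
  refine memLp_two_of_sq (integrable_upperExp x hε).1
    (integrable_upperExp 0 (ε := 2 * ε) (by positivity)).norm fun ξ => ?_
  unfold upperExp
  by_cases h : ξ ∈ Set.Ioi (0 : ℝ)
  · simp only [Set.indicator_of_mem h, Complex.norm_exp, ← Real.exp_nat_mul]
    congr 1
    simp; ring
  · simp [Set.indicator_of_notMem h]

theorem memLp_lowerExp (x : ℝ) {ε : ℝ} (hε : 0 < ε) : MemLp (lowerExp x ε) 2 := by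
  refine memLp_two_of_sq (integrable_lowerExp x hε).1
    (integrable_lowerExp 0 (ε := 2 * ε) (by positivity)).norm fun ξ => ?_
  unfold lowerExp
  by_cases h : ξ ∈ Set.Iic (0 : ℝ)
  · simp only [Set.indicator_of_mem h, Complex.norm_exp, ← Real.exp_nat_mul]
    congr 1
    simp; ring
  · simp [Set.indicator_of_notMem h]

theorem fourier_upperExp (x : ℝ) {ε : ℝ} (hε : 0 < ε) :
    𝓕 (upperExp x ε) = fun y : ℝ => Complex.I / (2 * Real.pi) * (1 / ((x : ℂ) - y + Complex.I * ε)) := by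
  funext y
  have hpi := Real.pi_pos
  rw [Real.fourier_real_eq_integral_exp_smul]
  have h1 : (fun v : ℝ => Complex.exp (↑(-2 * Real.pi * v * y) * Complex.I) • upperExp x ε v) =
      (Set.Ioi (0 : ℝ)).indicator (fun ξ : ℝ =>
        Complex.exp ((2 * Real.pi * (Complex.I * (x - y) - ε)) * ξ)) := by
    funext v
    unfold upperExp
    by_cases h : v ∈ Set.Ioi (0 : ℝ)
    · simp only [Set.indicator_of_mem h, smul_eq_mul, ← Complex.exp_add]
      congr 1
      push_cast; ring
    · simp [Set.indicator_of_notMem h]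
  rw [h1, integral_indicator measurableSet_Ioi, integral_exp_mul_complex_Ioi]
  · have h2 : ((x : ℂ) - y + Complex.I * ε) ≠ 0 := by
      intro h
      have := congrArg Complex.im h
      simp at this; exact hε.ne' this
    have h3 : (Complex.I * (x - y) - ε : ℂ) = Complex.I * ((x : ℂ) - y + Complex.I * ε) := by
      linear_combination (-(ε : ℂ)) * Complex.I_sq
    rw [h3]
    have hpi' : (Real.pi : ℂ) ≠ 0 := by exact_mod_cast hpi.ne'
    simp only [Complex.ofReal_zero, mul_zero, Complex.exp_zero]
    field_simp
    simp
  · simp; positivity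

theorem fourier_lowerExp (x : ℝ) {ε : ℝ} (hε : 0 < ε) :
    𝓕 (lowerExp x ε) = fun y : ℝ => -Complex.I / (2 * Real.pi) * (1 / ((x : ℂ) - y - Complex.I * ε)) := by
  funext y
  have hpi := Real.pi_pos
  rw [Real.fourier_real_eq_integral_exp_smul]
  have h1 : (fun v : ℝ => Complex.exp (↑(-2 * Real.pi * v * y) * Complex.I) • lowerExp x ε v) =
      (Set.Iic (0 : ℝ)).indicator (fun ξ : ℝ =>
        Complex.exp ((2 * Real.pi * (Complex.I * (x - y) + ε)) * ξ)) := by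
    funext v
    unfold lowerExp
    by_cases h : v ∈ Set.Iic (0 : ℝ)
    · simp only [Set.indicator_of_mem h, smul_eq_mul, ← Complex.exp_add]
      congr 1
      push_cast; ring
    · simp [Set.indicator_of_notMem h]
  rw [h1, integral_indicator measurableSet_Iic, integral_exp_mul_complex_Iic]
  · have h2 : ((x : ℂ) - y - Complex.I * ε) ≠ 0 := by
      intro h
      have := congrArg Complex.im h
      simp at this; exact hε.ne' this
    have h3 : (Complex.I * (x - y) + ε : ℂ) = Complex.I * ((x : ℂ) - y - Complex.I * ε) := by
      linear_combination ((ε : ℂ)) * Complex.I_sq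
    rw [h3]
    have hpi' : (Real.pi : ℂ) ≠ 0 := by exact_mod_cast hpi.ne'
    simp only [Complex.ofReal_zero, mul_zero, Complex.exp_zero]
    field_simp
    simp
  · simp; positivity

theorem integrable_inv_sq_add_sq (x : ℝ) {ε : ℝ} (hε : 0 < ε) :
    Integrable fun y : ℝ => ((x - y) ^ 2 + ε ^ 2)⁻¹ := by
  have h := ((integrable_inv_one_add_sq.comp_div hε.ne').const_mul (ε⁻¹ ^ 2)).comp_sub_left x
  refine h.congr (Eventually.of_forall fun y => ?_)
  simp only
  field_simp
  ring

theorem memLp_cauchy (x : ℝ) {ε : ℝ} (hε : ε ≠ 0) :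
    MemLp (fun y : ℝ => 1 / ((x : ℂ) - y + Complex.I * ε)) 2 := by
  refine memLp_two_of_sq (Measurable.aestronglyMeasurable (by fun_prop))
    (integrable_inv_sq_add_sq x (abs_pos.mpr hε)) fun y => ?_
  rw [norm_div, norm_one, div_pow, one_pow, one_div, ← Complex.normSq_eq_norm_sq,
    Complex.normSq_apply, sq_abs]
  congr 1
  simp
  ring

theorem memLp_cauchy' (x : ℝ) {ε : ℝ} (hε : ε ≠ 0) :
    MemLp (fun y : ℝ => 1 / ((x : ℂ) - y - Complex.I * ε)) 2 := by
  have := memLp_cauchy x (neg_ne_zero.mpr hε)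
  simpa [sub_eq_add_neg] using this

/-- The kernel is a multiple of `𝓕 (upperExp x ε)`, and `upperExp` lives on the half-line where the
symbol is `-1`. -/
theorem integral_cauchy_mul_lineH (x : ℝ) {ε : ℝ} (hε : 0 < ε) (u : Lp ℂ 2 (volume : Measure ℝ)) :
    ∫ y : ℝ, 1 / ((x : ℂ) - y + Complex.I * ε) * lineH u y =
      - ∫ y : ℝ, 1 / ((x : ℂ) - y + Complex.I * ε) * u y := by
  have h := integral_fourier_mul_lineH (c := -1) (integrable_upperExp x hε) (memLp_upperExp x hε)
    (by rw [fourier_upperExp x hε]; exact (memLp_cauchy x hε.ne').const_mul _) (fun ξ => by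
      unfold upperExp symbolH
      by_cases h : ξ ∈ Set.Ioi (0 : ℝ)
      · rw [if_pos (show 0 < ξ from h)]; ring
      · simp [Set.indicator_of_notMem h]) u
  rw [fourier_upperExp x hε] at h
  simp only [mul_assoc, integral_const_mul] at h
  have h0 : Complex.I / (2 * Real.pi) ≠ 0 := by
    simp [Real.pi_ne_zero]
  apply mul_left_cancel₀ h0
  rw [h]; ring

theorem integral_cauchy_mul_lineH' (x : ℝ) {ε : ℝ} (hε : 0 < ε) (u : Lp ℂ 2 (volume : Measure ℝ)) :
    ∫ y : ℝ, 1 / ((x : ℂ) - y - Complex.I * ε) * lineH u y =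
      ∫ y : ℝ, 1 / ((x : ℂ) - y - Complex.I * ε) * u y := by
  have h := integral_fourier_mul_lineH (c := 1) (integrable_lowerExp x hε) (memLp_lowerExp x hε)
    (by rw [fourier_lowerExp x hε]; exact (memLp_cauchy' x hε.ne').const_mul _) (fun ξ => by
      unfold lowerExp symbolH
      -- The symbol is `1` also at `ξ = 0`, which matches the closed half-line carrying `lowerExp`.
      by_cases h : ξ ∈ Set.Iic (0 : ℝ)
      · rw [if_neg (not_lt.mpr h)]; ring
      · simp [Set.indicator_of_notMem h]) u
  rw [fourier_lowerExp x hε] at h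
  simp only [mul_assoc, integral_const_mul] at h
  have h0 : -Complex.I / (2 * Real.pi) ≠ 0 := by
    simp [Real.pi_ne_zero]
  apply mul_left_cancel₀ h0
  rw [h]; ring

theorem integrable_cauchy_mul (x : ℝ) {ε : ℝ} (hε : ε ≠ 0) {u : ℝ → ℂ} (hu : MemLp u 2 volume) :
    Integrable fun y : ℝ => 1 / ((x : ℂ) - y + Complex.I * ε) * u y :=
  (memLp_cauchy x hε).integrable_mul hu

theorem integrable_cauchy_mul' (x : ℝ) {ε : ℝ} (hε : ε ≠ 0) {u : ℝ → ℂ} (hu : MemLp u 2 volume) :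
    Integrable fun y : ℝ => 1 / ((x : ℂ) - y - Complex.I * ε) * u y :=
  (memLp_cauchy' x hε).integrable_mul hu

theorem cauchy_sub_cauchy (t : ℝ) {ε : ℝ} (hε : ε ≠ 0) :
    1 / ((t : ℂ) - Complex.I * ε) - 1 / ((t : ℂ) + Complex.I * ε) =
      2 * Complex.I * ((ε / (t ^ 2 + ε ^ 2) : ℝ) : ℂ) := by
  have h1 : ((t : ℂ) - Complex.I * ε) ≠ 0 := by
    intro h; have := congrArg Complex.im h; simp at this; exact hε this
  have h2 : ((t : ℂ) + Complex.I * ε) ≠ 0 := by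
    intro h; have := congrArg Complex.im h; simp at this; exact hε this
  have h3 : ((t : ℂ) ^ 2 + (ε : ℂ) ^ 2) = (t - Complex.I * ε) * (t + Complex.I * ε) := by
    linear_combination ((ε : ℂ) ^ 2) * Complex.I_sq
  push_cast
  rw [h3]
  field_simp
  ring

theorem cauchy_add_cauchy (t : ℝ) {ε : ℝ} (hε : ε ≠ 0) :
    1 / ((t : ℂ) - Complex.I * ε) + 1 / ((t : ℂ) + Complex.I * ε) =
      2 * ((t / (t ^ 2 + ε ^ 2) : ℝ) : ℂ) := by
  have h1 : ((t : ℂ) - Complex.I * ε) ≠ 0 := by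
    intro h; have := congrArg Complex.im h; simp at this; exact hε this
  have h2 : ((t : ℂ) + Complex.I * ε) ≠ 0 := by
    intro h; have := congrArg Complex.im h; simp at this; exact hε this
  have h3 : ((t : ℂ) ^ 2 + (ε : ℂ) ^ 2) = (t - Complex.I * ε) * (t + Complex.I * ε) := by
    linear_combination ((ε : ℂ) ^ 2) * Complex.I_sq
  push_cast
  rw [h3]
  field_simp
  ring

/-- The Poisson integral of the Hilbert transform is the conjugate Poisson integral. -/
theorem integral_poisson_mul_lineH (x : ℝ) {ε : ℝ} (hε : 0 < ε) (u : Lp ℂ 2 (volume : Measure ℝ)) :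
    Complex.I * ∫ y : ℝ, ((ε / ((x - y) ^ 2 + ε ^ 2) : ℝ) : ℂ) * lineH u y =
      ∫ y : ℝ, (((x - y) / ((x - y) ^ 2 + ε ^ 2) : ℝ) : ℂ) * u y := by
  have h1 := integral_cauchy_mul_lineH x hε u
  have h2 := integral_cauchy_mul_lineH' x hε u
  have h3 : 2 * (Complex.I * ∫ y : ℝ, ((ε / ((x - y) ^ 2 + ε ^ 2) : ℝ) : ℂ) * lineH u y) =
      ∫ y : ℝ, 1 / ((x : ℂ) - y - Complex.I * ε) * lineH u y -
        1 / ((x : ℂ) - y + Complex.I * ε) * lineH u y := by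
    rw [← integral_const_mul, ← integral_const_mul]
    congr 1
    funext y
    have := cauchy_sub_cauchy (x - y) hε.ne'
    push_cast at this ⊢
    rw [← sub_mul, this]; ring
  have h4 : 2 * ∫ y : ℝ, (((x - y) / ((x - y) ^ 2 + ε ^ 2) : ℝ) : ℂ) * u y =
      ∫ y : ℝ, 1 / ((x : ℂ) - y - Complex.I * ε) * u y +
        1 / ((x : ℂ) - y + Complex.I * ε) * u y := by
    rw [← integral_const_mul]
    congr 1
    funext y
    have := cauchy_add_cauchy (x - y) hε.ne'
    push_cast at this ⊢
    rw [← add_mul, this]; ring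
  -- The two Cauchy kernels see `lineH` with opposite signs, so their difference against `lineH u`
  -- turns into their sum against `u`.
  rw [integral_sub (integrable_cauchy_mul' x hε.ne' (Lp.memLp _))
    (integrable_cauchy_mul x hε.ne' (Lp.memLp _)), h1, h2, sub_neg_eq_add,
    ← integral_add (integrable_cauchy_mul' x hε.ne' (Lp.memLp _))
    (integrable_cauchy_mul x hε.ne' (Lp.memLp _)), ← h4] at h3
  exact mul_left_cancel₀ two_ne_zero h3

end LineHilbertTransform

/-! ### Poisson integrals at Lebesgue points. -/

section LebesguePoints

/-- Dyadic domination of the Poisson kernel. -/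
theorem poisson_le_tsum_dyadic {ε : ℝ} (hε : 0 < ε) (x y : ℝ) :
    ENNReal.ofReal (ε / ((x - y) ^ 2 + ε ^ 2)) ≤
      ∑' k : ℕ, ENNReal.ofReal (4 / (4 ^ k * ε)) *
        (Metric.closedBall x (2 ^ k * ε)).indicator 1 y := by
  have hex : ∃ k : ℕ, |x - y| ≤ 2 ^ k * ε := by
    obtain ⟨k, hk⟩ := pow_unbounded_of_one_lt (|x - y| / ε) (one_lt_two : (1 : ℝ) < 2)
    exact ⟨k, by rw [div_lt_iff₀ hε] at hk; exact hk.le⟩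
  classical
  -- One term of the series suffices: the smallest dyadic ball containing `y`. For `k > 0`,
  -- minimality gives `(x - y)² ≥ 4^(k-1) ε²`, whence the factor 4.
  let k := Nat.find hex
  have hk : |x - y| ≤ 2 ^ k * ε := Nat.find_spec hex
  refine le_trans ?_ (ENNReal.le_tsum k)
  have hmem : y ∈ Metric.closedBall x (2 ^ k * ε) := by
    rw [Metric.mem_closedBall, dist_comm, Real.dist_eq]; exact hk
  rw [Set.indicator_of_mem hmem, Pi.one_apply, mul_one]
  refine ENNReal.ofReal_le_ofReal ?_
  have hpos : 0 < (x - y) ^ 2 + ε ^ 2 := by positivity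
  rw [div_le_div_iff₀ hpos (by positivity)]
  rcases Nat.eq_zero_or_pos k with h0 | h0
  · rw [h0]; nlinarith [sq_nonneg (x - y), sq_nonneg ε]
  · obtain ⟨j, hj⟩ : ∃ j, k = j + 1 := ⟨k - 1, by omega⟩
    have hlt : ¬ |x - y| ≤ 2 ^ j * ε := Nat.find_min hex (by omega)
    rw [not_le] at hlt
    have h2 : (2 ^ j * ε) ^ 2 ≤ (x - y) ^ 2 := by
      rw [← sq_abs (x - y)]
      exact pow_le_pow_left₀ (by positivity) hlt.le 2
    have h3 : (4 : ℝ) ^ k = 4 * (2 ^ j) ^ 2 := by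
      rw [hj, pow_succ, ← pow_mul, mul_comm j 2, pow_mul]; norm_num; ring
    rw [h3]
    nlinarith [sq_nonneg ε]

theorem tsum_four_div_two_pow : ∑' k : ℕ, ENNReal.ofReal (4 / 2 ^ k) = 8 := by
  have h : ∀ k : ℕ, ENNReal.ofReal (4 / 2 ^ k) = 4 * (2⁻¹ : ℝ≥0∞) ^ k := fun k => by
    rw [div_eq_mul_inv, ENNReal.ofReal_mul (by norm_num), ENNReal.ofReal_inv_of_pos (by positivity),
      ENNReal.ofReal_pow (by norm_num), ENNReal.inv_pow]
    norm_num
  simp_rw [h]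
  rw [ENNReal.tsum_mul_left, ENNReal.tsum_geometric_two]
  norm_num

/-- In the dyadic domination the ball of radius `2^k ε` carries mass at most `η 2^k ε` and weight `4
/ (4^k ε)`; the resulting geometric series has sum `8η`, independently of `ε`. -/
theorem lintegral_poisson_closedBall_le {g : ℝ → ℝ≥0∞} (hg : AEMeasurable g) {x δ : ℝ} {η : ℝ≥0∞}
    (hδ : 0 < δ) (h : ∀ r, 0 < r → r ≤ δ →
      ∫⁻ y in Metric.closedBall x r, g y ≤ η * ENNReal.ofReal r) {ε : ℝ} (hε : 0 < ε) :
    ∫⁻ y in Metric.closedBall x δ, ENNReal.ofReal (ε / ((x - y) ^ 2 + ε ^ 2)) * g y ≤ 8 * η := by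
  have hind : ∀ k : ℕ, Measurable ((Metric.closedBall x (2 ^ k * ε)).indicator (1 : ℝ → ℝ≥0∞)) :=
    fun k => measurable_one.indicator Metric.isClosed_closedBall.measurableSet
  calc ∫⁻ y in Metric.closedBall x δ, ENNReal.ofReal (ε / ((x - y) ^ 2 + ε ^ 2)) * g y
      ≤ ∫⁻ y in Metric.closedBall x δ, ∑' k : ℕ, ENNReal.ofReal (4 / (4 ^ k * ε)) *
        ((Metric.closedBall x (2 ^ k * ε)).indicator 1 y * g y) := by
        refine lintegral_mono fun y => ?_
        simp_rw [← mul_assoc]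
        rw [ENNReal.tsum_mul_right]
        gcongr
        exact poisson_le_tsum_dyadic hε x y
    _ = ∑' k : ℕ, ENNReal.ofReal (4 / (4 ^ k * ε)) * ∫⁻ y in Metric.closedBall x δ,
        (Metric.closedBall x (2 ^ k * ε)).indicator 1 y * g y := by
        rw [lintegral_tsum]
        · congr 1
          funext k
          rw [lintegral_const_mul' _ _ ENNReal.ofReal_ne_top]
        · intro k
          exact (((hind k).aemeasurable.mul hg).const_mul _).restrict
    _ ≤ ∑' k : ℕ, ENNReal.ofReal (4 / (4 ^ k * ε)) * (η * ENNReal.ofReal (2 ^ k * ε)) := by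
        refine ENNReal.tsum_le_tsum fun k => ?_
        gcongr
        have h1 : (fun y => (Metric.closedBall x (2 ^ k * ε)).indicator 1 y * g y) =
            (Metric.closedBall x (2 ^ k * ε)).indicator g := by
          funext y
          by_cases hy : y ∈ Metric.closedBall x (2 ^ k * ε) <;> simp [hy]
        rw [h1, lintegral_indicator Metric.isClosed_closedBall.measurableSet,
          Measure.restrict_restrict Metric.isClosed_closedBall.measurableSet]
        have h2 : Metric.closedBall x (2 ^ k * ε) ∩ Metric.closedBall x δ ⊆
            Metric.closedBall x (min (2 ^ k * ε) δ) := by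
          rintro y ⟨h3, h4⟩
          rw [Metric.mem_closedBall] at *
          exact le_min h3 h4
        refine (lintegral_mono_set h2).trans ((h _ (lt_min (by positivity) hδ) (min_le_right _ _)).trans ?_)
        gcongr
        exact min_le_left _ _
    _ = ∑' k : ℕ, ENNReal.ofReal (4 / 2 ^ k) * η := by
        congr 1
        funext k
        rw [mul_comm η, ← mul_assoc, ← ENNReal.ofReal_mul (by positivity)]
        congr 2
        have : (4 : ℝ) ^ k = 2 ^ k * 2 ^ k := by rw [← mul_pow]; norm_num
        rw [this]
        field_simp
    _ = 8 * η := by rw [ENNReal.tsum_mul_right, tsum_four_div_two_pow]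

theorem memLp_poisson (x : ℝ) {ε : ℝ} (hε : ε ≠ 0) :
    MemLp (fun y : ℝ => ((ε / ((x - y) ^ 2 + ε ^ 2) : ℝ) : ℂ)) 2 := by
  have h := ((memLp_cauchy' x hε).sub (memLp_cauchy x hε)).const_mul (1 / (2 * Complex.I))
  refine h.ae_eq (Eventually.of_forall fun y => ?_)
  have := cauchy_sub_cauchy (x - y) hε
  simp only [Pi.sub_apply]
  push_cast at this ⊢
  rw [this]
  field_simp

theorem integrable_poisson (x : ℝ) {ε : ℝ} (hε : 0 < ε) :
    Integrable fun y : ℝ => ((ε / ((x - y) ^ 2 + ε ^ 2) : ℝ) : ℂ) := by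
  have h : Integrable fun y : ℝ => ε / ((x - y) ^ 2 + ε ^ 2) := by
    simpa only [div_eq_mul_inv] using (integrable_inv_sq_add_sq x hε).const_mul ε
  exact h.ofReal

theorem integrable_poisson_mul_sub (x : ℝ) {ε : ℝ} (hε : 0 < ε) {u : ℝ → ℂ}
    (hu : MemLp u 2 volume) (c : ℂ) :
    Integrable fun y : ℝ => ((ε / ((x - y) ^ 2 + ε ^ 2) : ℝ) : ℂ) * (u y - c) := by
  simp_rw [mul_sub]
  exact ((memLp_poisson x hε.ne').integrable_mul hu).sub ((integrable_poisson x hε).mul_const c)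

theorem enorm_poisson {ε : ℝ} (hε : 0 < ε) (t : ℝ) :
    ‖((ε / (t ^ 2 + ε ^ 2) : ℝ) : ℂ)‖ₑ = ENNReal.ofReal (ε / (t ^ 2 + ε ^ 2)) := by
  rw [← ofReal_norm, Complex.norm_real, Real.norm_of_nonneg (by positivity)]

/-- At almost every point, the Poisson means of the oscillation of an `L²` function vanish. -/
theorem ae_tendsto_lintegral_poisson {u : ℝ → ℂ} (hu : MemLp u 2 volume) :
    ∀ᵐ x : ℝ, Tendsto (fun ε : ℝ => ∫⁻ y : ℝ, ENNReal.ofReal (ε / ((x - y) ^ 2 + ε ^ 2)) *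
      ‖u y - u x‖ₑ) (𝓝[>] 0) (𝓝 0) := by
  have hloc : LocallyIntegrable u volume := hu.locallyIntegrable (by norm_num)
  filter_upwards [VitaliFamily.ae_tendsto_lintegral_enorm_sub_div
    (IsUnifLocDoublingMeasure.vitaliFamily (volume : Measure ℝ) 1) hloc] with x hx
  have hx' : Tendsto (fun r : ℝ => (∫⁻ y in Metric.closedBall x r, ‖u y - u x‖ₑ) /
      volume (Metric.closedBall x r)) (𝓝[>] 0) (𝓝 0) := by
    refine hx.comp (IsUnifLocDoublingMeasure.tendsto_closedBall_filterAt volume (fun _ => x)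
      (fun r => r) tendsto_id ?_)
    filter_upwards [self_mem_nhdsWithin] with r hr
    exact Metric.mem_closedBall_self (by rw [one_mul]; exact le_of_lt hr)
  have hg : AEMeasurable (fun y => ‖u y - u x‖ₑ) :=
    (hu.1.sub aestronglyMeasurable_const).enorm
  rw [ENNReal.tendsto_nhds_zero]
  intro e he
  -- The 2 is the length `2r` of a ball of radius `r`, the 8 comes from the dyadic series.
  obtain ⟨η, hη0, hηe⟩ : ∃ η : ℝ≥0∞, 0 < η ∧ 8 * (2 * η) ≤ e / 2 := by
    refine ⟨e / 2 / 16, ?_, ?_⟩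
    · exact ENNReal.div_pos (ENNReal.div_pos he.ne' (by norm_num)).ne' (by norm_num)
    · rw [← mul_assoc]
      norm_num
      rw [ENNReal.mul_div_cancel (by norm_num) (by norm_num)]
  have hev := (ENNReal.tendsto_nhds_zero.mp hx') η hη0
  obtain ⟨δ, hδ, hball⟩ := mem_nhdsGT_iff_exists_Ioc_subset.mp hev
  have hδ' : (0 : ℝ) < δ := hδ
  have hclose : ∀ r, 0 < r → r ≤ δ →
      ∫⁻ y in Metric.closedBall x r, ‖u y - u x‖ₑ ≤ 2 * η * ENNReal.ofReal r := by
    intro r hr hrδ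
    have h1 : (∫⁻ y in Metric.closedBall x r, ‖u y - u x‖ₑ) /
      volume (Metric.closedBall x r) ≤ η := hball ⟨hr, hrδ⟩
    rw [Real.volume_closedBall, ENNReal.div_le_iff (by simpa using hr) ENNReal.ofReal_ne_top,
      ENNReal.ofReal_mul (by norm_num)] at h1
    refine h1.trans (le_of_eq ?_)
    rw [ENNReal.ofReal_ofNat]; ring
  set K : ℝ≥0∞ := ∫⁻ y : ℝ, ‖((δ / ((x - y) ^ 2 + δ ^ 2) : ℝ) : ℂ) * (u y - u x)‖ₑ with hK
  have hKtop : K ≠ ∞ := (integrable_poisson_mul_sub x hδ' hu (u x)).2.ne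
  -- Where `|x - y| > δ`, the Poisson kernel at height `ε` is at most `2ε / δ` times the one at the
  -- fixed height `δ`, against which the oscillation is integrable.
  have hfar : ∀ ε : ℝ, 0 < ε → ∫⁻ y in (Metric.closedBall x δ)ᶜ,
      ENNReal.ofReal (ε / ((x - y) ^ 2 + ε ^ 2)) * ‖u y - u x‖ₑ ≤ ENNReal.ofReal (2 * ε / δ) * K := by
    intro ε hε
    rw [hK, ← lintegral_const_mul' _ _ ENNReal.ofReal_ne_top]
    refine le_trans (setLIntegral_mono' Metric.isClosed_closedBall.measurableSet.compl fun y hy => ?_)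
      (setLIntegral_le_lintegral _ _)
    rw [enorm_mul, ← mul_assoc, enorm_poisson hδ', ← ENNReal.ofReal_mul (by positivity)]
    gcongr
    have hy' : δ < |x - y| := by
      rw [Set.mem_compl_iff, Metric.mem_closedBall, dist_comm, Real.dist_eq, not_le] at hy
      exact hy
    have hsq : δ ^ 2 ≤ (x - y) ^ 2 := by
      rw [← sq_abs (x - y)]; exact pow_le_pow_left₀ hδ'.le hy'.le 2
    have hδ2 : 0 < δ ^ 2 := by positivity
    rw [div_mul_div_comm, div_le_div_iff₀ (by positivity) (by positivity)]
    have : 0 ≤ ε * δ := by positivity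
    nlinarith [mul_le_mul_of_nonneg_left hsq this, mul_nonneg this (sq_nonneg ε)]
  have hsmall : ∀ᶠ ε : ℝ in 𝓝[>] 0, ENNReal.ofReal (2 * ε / δ) * K ≤ e / 2 := by
    have h1 : Tendsto (fun ε : ℝ => ENNReal.ofReal (2 * ε / δ) * K) (𝓝[>] 0) (𝓝 0) := by
      have h2 : Tendsto (fun ε : ℝ => ENNReal.ofReal (2 * ε / δ)) (𝓝[>] 0) (𝓝 0) := by
        have h3 : Continuous fun ε : ℝ => ENNReal.ofReal (2 * ε / δ) :=
          ENNReal.continuous_ofReal.comp (by fun_prop)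
        simpa using (h3.tendsto 0).mono_left nhdsWithin_le_nhds
      simpa using ENNReal.Tendsto.mul_const h2 (Or.inr hKtop)
    exact (ENNReal.tendsto_nhds_zero.mp h1) _ (ENNReal.div_pos he.ne' (by norm_num))
  filter_upwards [hsmall, self_mem_nhdsWithin] with ε h1 hε
  rw [← lintegral_add_compl _ (Metric.isClosed_closedBall (x := x) (ε := δ)).measurableSet]
  calc _ ≤ e / 2 + e / 2 := add_le_add
        ((lintegral_poisson_closedBall_le hg hδ' hclose hε).trans hηe) ((hfar ε hε).trans h1)
    _ = e := ENNReal.add_halves e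

/-- Kernels dominated by the Poisson kernel do not see an `L²` function minus its value. -/
theorem tendsto_integral_kernel_mul_sub {u : ℝ → ℂ} {x : ℝ}
    (hx : Tendsto (fun ε : ℝ => ∫⁻ y : ℝ, ENNReal.ofReal (ε / ((x - y) ^ 2 + ε ^ 2)) *
      ‖u y - u x‖ₑ) (𝓝[>] 0) (𝓝 0)) {k : ℝ → ℝ → ℂ}
    (hk : ∀ ε, 0 < ε → ∀ t, ‖k ε t‖ ≤ ε / (t ^ 2 + ε ^ 2)) :
    Tendsto (fun ε : ℝ => ∫ y : ℝ, k ε (x - y) * (u y - u x)) (𝓝[>] 0) (𝓝 0) := by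
  rw [tendsto_zero_iff_enorm_tendsto_zero]
  refine tendsto_of_tendsto_of_tendsto_of_le_of_le' tendsto_const_nhds hx
    (Eventually.of_forall fun _ => bot_le) ?_
  filter_upwards [self_mem_nhdsWithin] with ε hε
  refine (enorm_integral_le_lintegral_enorm _).trans (lintegral_mono fun y => ?_)
  rw [enorm_mul]
  gcongr
  rw [← ofReal_norm]
  exact ENNReal.ofReal_le_ofReal (hk ε hε _)

theorem integral_poisson (x : ℝ) {ε : ℝ} (hε : 0 < ε) :
    ∫ y : ℝ, ((ε / ((x - y) ^ 2 + ε ^ 2) : ℝ) : ℂ) = Real.pi := by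
  rw [integral_complex_ofReal]
  congr 1
  rw [integral_sub_left_eq_self (fun t : ℝ => ε / (t ^ 2 + ε ^ 2)) volume x]
  have h := Measure.integral_comp_div (fun t : ℝ => (1 + t ^ 2)⁻¹) ε
  rw [integral_univ_inv_one_add_sq, abs_of_pos hε, smul_eq_mul] at h
  have h2 : (fun t : ℝ => ε / (t ^ 2 + ε ^ 2)) = fun t : ℝ => ε⁻¹ * (1 + (t / ε) ^ 2)⁻¹ := by
    funext t; field_simp; ring
  rw [h2, integral_const_mul, h]
  field_simp

/-- Poisson integrals of an `L²` function converge almost everywhere. -/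
theorem tendsto_integral_poisson_mul {u : ℝ → ℂ} (hu : MemLp u 2 volume) {x : ℝ}
    (hx : Tendsto (fun ε : ℝ => ∫⁻ y : ℝ, ENNReal.ofReal (ε / ((x - y) ^ 2 + ε ^ 2)) *
      ‖u y - u x‖ₑ) (𝓝[>] 0) (𝓝 0)) :
    Tendsto (fun ε : ℝ => ∫ y : ℝ, ((ε / ((x - y) ^ 2 + ε ^ 2) : ℝ) : ℂ) * u y) (𝓝[>] 0)
      (𝓝 (Real.pi * u x)) := by
  have h := tendsto_integral_kernel_mul_sub (k := fun ε t => ((ε / (t ^ 2 + ε ^ 2) : ℝ) : ℂ)) hx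
    (fun ε hε t => by
      rw [Complex.norm_real, Real.norm_of_nonneg (by positivity)])
  have h2 := h.add_const ((Real.pi : ℂ) * u x)
  rw [zero_add] at h2
  refine h2.congr' ?_
  filter_upwards [self_mem_nhdsWithin] with ε hε
  have h3 := (integrable_poisson x hε).mul_const (u x)
  rw [← integral_poisson x hε, ← integral_mul_const, ← integral_add
    (integrable_poisson_mul_sub x hε hu _) h3]
  congr 1
  funext y
  ring

end LebesguePoints

/-! ### The finite Hilbert transformation as a compression and as a principal value. -/

section FiniteTransform

variable (a b : ℝ)

theorem memLp_indicator_Ioo {a b : ℝ} (u : L2 a b) :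
    MemLp ((Set.Ioo a b).indicator u) 2 (volume : Measure ℝ) :=
  (memLp_indicator_iff_restrict measurableSet_Ioo).mpr (Lp.memLp u)

/-- Extension by zero from `L²(Ω)` to `L²(ℝ)`. -/
def extendL : L2 a b →ₗᵢ[ℂ] Lp ℂ 2 (volume : Measure ℝ) where
  toFun u := (memLp_indicator_Ioo u).toLp _
  map_add' u v := by
    rw [← MemLp.toLp_add]
    refine MemLp.toLp_congr _ _ ?_
    have h := (ae_restrict_iff' (measurableSet_Ioo (a := a) (b := b))).mp (Lp.coeFn_add u v)
    filter_upwards [h] with x hx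
    by_cases hm : x ∈ Set.Ioo a b
    · simpa only [Set.indicator_of_mem hm, Pi.add_apply] using hx hm
    · simp [hm]
  map_smul' c u := by
    rw [RingHom.id_apply, ← MemLp.toLp_const_smul]
    refine MemLp.toLp_congr _ _ ?_
    have h := (ae_restrict_iff' (measurableSet_Ioo (a := a) (b := b))).mp (Lp.coeFn_smul c u)
    filter_upwards [h] with x hx
    by_cases hm : x ∈ Set.Ioo a b
    · simp [hm, hx hm]
    · simp [hm]
  norm_map' u := by
    change ‖(memLp_indicator_Ioo u).toLp _‖ = ‖u‖
    rw [Lp.norm_toLp, Lp.norm_def, eLpNorm_indicator_eq_eLpNorm_restrict measurableSet_Ioo]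

variable {a b}

theorem coeFn_extendL (u : L2 a b) :
    extendL a b u =ᵐ[volume] (Set.Ioo a b).indicator u :=
  (memLp_indicator_Ioo u).coeFn_toLp

theorem integral_mul_extendL (k : ℝ → ℂ) (u : L2 a b) :
    ∫ y, k y * extendL a b u y = ∫ y in Set.Ioo a b, k y * u y := by
  rw [← integral_indicator measurableSet_Ioo]
  refine integral_congr_ae ?_
  filter_upwards [coeFn_extendL u] with y hy
  rw [hy]
  by_cases hm : y ∈ Set.Ioo a b <;> simp [hm]

variable (a b) in
/-- The finite Hilbert transformation `A_Ω`. -/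
def finiteH : L2 a b →L[ℂ] L2 a b :=
  LpToLpRestrictCLM ℝ ℂ ℂ volume 2 (Set.Ioo a b) ∘L lineH ∘L
    (extendL a b).toContinuousLinearMap

theorem coeFn_finiteH (u : L2 a b) :
    finiteH a b u =ᵐ[volume.restrict (Set.Ioo a b)] lineH (extendL a b u) :=
  LpToLpRestrictCLM_coeFn ℂ (Set.Ioo a b) (lineH (extendL a b u))

/-- Restriction to `Ω` is adjoint to extension by zero; the symmetry of `finiteH` is thereby
inherited from `lineH`. -/
theorem inner_finiteH (u v : L2 a b) :
    inner ℂ (finiteH a b u) v = inner ℂ (lineH (extendL a b u)) (extendL a b v) := by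
  rw [L2.inner_def, L2.inner_def, ← integral_indicator measurableSet_Ioo]
  refine integral_congr_ae ?_
  have h := (ae_restrict_iff' (measurableSet_Ioo (a := a) (b := b))).mp (coeFn_finiteH u)
  filter_upwards [h, coeFn_extendL v] with x h1 h2
  rw [h2]
  by_cases hm : x ∈ Set.Ioo a b
  · simp [hm, h1 hm]
  · simp [hm]

theorem isSelfAdjoint_finiteH : IsSelfAdjoint (finiteH a b) := by
  rw [ContinuousLinearMap.isSelfAdjoint_iff_isSymmetric]
  intro u v
  change inner ℂ (finiteH a b u) v = inner ℂ u (finiteH a b v)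
  rw [inner_finiteH, inner_lineH_left, ← inner_conj_symm u, inner_finiteH, inner_conj_symm]

theorem norm_finiteH_apply_le (u : L2 a b) : ‖finiteH a b u‖ ≤ ‖u‖ := by
  have h1 : ‖finiteH a b u‖ ≤ ‖lineH (extendL a b u)‖ := by
    rw [Lp.norm_def, Lp.norm_def]
    refine ENNReal.toReal_mono (Lp.eLpNorm_ne_top _) ?_
    rw [eLpNorm_congr_ae (coeFn_finiteH u)]
    exact eLpNorm_mono_measure _ Measure.restrict_le_self
  exact h1.trans ((norm_lineH_le _).trans (by rw [LinearIsometry.norm_map]))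

/-- The difference between the truncated Cauchy kernel and the conjugate Poisson kernel. -/
def truncationError (ε t : ℝ) : ℝ := (if ε < |t| then 1 / t else 0) - t / (t ^ 2 + ε ^ 2)

theorem measurable_truncationError (ε : ℝ) : Measurable (truncationError ε) := by
  unfold truncationError
  refine Measurable.sub (Measurable.ite ?_ (by fun_prop) measurable_const) (by fun_prop)
  exact measurableSet_lt measurable_const (by fun_prop)

theorem abs_truncationError_le {ε : ℝ} (hε : 0 < ε) (t : ℝ) :
    |truncationError ε t| ≤ ε / (t ^ 2 + ε ^ 2) := by
  have hpos : 0 < t ^ 2 + ε ^ 2 := by positivity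
  unfold truncationError
  split_ifs with h
  · have ht : 0 < |t| := hε.trans h
    have ht0 : t ≠ 0 := abs_pos.mp ht
    have h1 : 1 / t - t / (t ^ 2 + ε ^ 2) = ε ^ 2 / (t * (t ^ 2 + ε ^ 2)) := by
      field_simp; ring
    rw [h1, abs_div, abs_mul, abs_of_pos hpos, abs_of_nonneg (sq_nonneg ε),
      div_le_div_iff₀ (by positivity) hpos]
    have : 0 ≤ ε * (t ^ 2 + ε ^ 2) := by positivity
    nlinarith [mul_le_mul_of_nonneg_left h.le this]
  · rw [zero_sub, abs_neg, abs_div, abs_of_pos hpos]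
    gcongr
    exact not_lt.mp h

theorem truncationError_neg (ε t : ℝ) : truncationError ε (-t) = -truncationError ε t := by
  unfold truncationError
  rw [abs_neg, neg_sq]
  split_ifs <;> ring

theorem integral_truncationError (ε x : ℝ) :
    ∫ y : ℝ, ((truncationError ε (x - y) : ℝ) : ℂ) = 0 := by
  rw [integral_sub_left_eq_self (fun t : ℝ => ((truncationError ε t : ℝ) : ℂ)) volume x]
  have h := integral_neg_eq_self (fun t : ℝ => ((truncationError ε t : ℝ) : ℂ)) volume
  simp only [truncationError_neg, Complex.ofReal_neg, integral_neg] at h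
  exact self_eq_neg.mp h.symm

theorem memLp_truncationError (x : ℝ) {ε : ℝ} (hε : 0 < ε) :
    MemLp (fun y : ℝ => ((truncationError ε (x - y) : ℝ) : ℂ)) 2 := by
  refine (memLp_poisson x hε.ne').mono (Measurable.aestronglyMeasurable ?_)
    (Eventually.of_forall fun y => ?_)
  · exact Complex.measurable_ofReal.comp ((measurable_truncationError ε).comp (by fun_prop))
  · rw [Complex.norm_real, Complex.norm_real]
    exact (abs_truncationError_le hε _).trans (le_abs_self _)

theorem integrable_truncationError (x : ℝ) {ε : ℝ} (hε : 0 < ε) :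
    Integrable (fun y : ℝ => ((truncationError ε (x - y) : ℝ) : ℂ)) := by
  refine (integrable_poisson x hε).mono (memLp_truncationError x hε).1
    (Eventually.of_forall fun y => ?_)
  rw [Complex.norm_real, Complex.norm_real]
  exact (abs_truncationError_le hε _).trans (le_abs_self _)

theorem memLp_conjPoisson (x : ℝ) {ε : ℝ} (hε : ε ≠ 0) :
    MemLp (fun y : ℝ => (((x - y) / ((x - y) ^ 2 + ε ^ 2) : ℝ) : ℂ)) 2 := by
  have h := ((memLp_cauchy' x hε).add (memLp_cauchy x hε)).const_mul (1 / 2)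
  refine h.ae_eq (Eventually.of_forall fun y => ?_)
  have := cauchy_add_cauchy (x - y) hε
  simp only [Pi.add_apply]
  push_cast at this ⊢
  rw [this]
  field_simp

/-- The constant `c` is free because the odd kernel `truncationError` has integral zero. It will be
the value of `u` at `x`, so that the first integral vanishes in the limit at a Lebesgue point. -/
theorem truncatedIntegral_eq (u : L2 a b) {ε : ℝ} (hε : 0 < ε) (x : ℝ) (c : ℂ) :
    truncatedIntegral a b u ε x = 1 / (Complex.I * Real.pi) *
      ((∫ y : ℝ, ((truncationError ε (x - y) : ℝ) : ℂ) * (extendL a b u y - c)) +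
        ∫ y : ℝ, (((x - y) / ((x - y) ^ 2 + ε ^ 2) : ℝ) : ℂ) * extendL a b u y) := by
  have hu : MemLp (extendL a b u) 2 volume := Lp.memLp _
  have hD : Integrable fun y : ℝ => ((truncationError ε (x - y) : ℝ) : ℂ) * (extendL a b u y - c) := by
    simp_rw [mul_sub]
    exact ((memLp_truncationError x hε).integrable_mul hu).sub
      ((integrable_truncationError x hε).mul_const c)
  have hq := (memLp_conjPoisson x hε.ne').integrable_mul hu
  have hc : ∫ y : ℝ, ((truncationError ε (x - y) : ℝ) : ℂ) * c = 0 := by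
    rw [integral_mul_const, integral_truncationError, zero_mul]
  unfold truncatedIntegral
  congr 1
  rw [← add_zero (∫ y : ℝ, ((truncationError ε (x - y) : ℝ) : ℂ) * (extendL a b u y - c)), ← hc,
    ← integral_add hD ((integrable_truncationError x hε).mul_const c)]
  have hD2 := hD.add ((integrable_truncationError x hε).mul_const c)
  have hS : MeasurableSet {y : ℝ | ε < |x - y|} :=
    measurableSet_lt measurable_const (by fun_prop)
  refine Eq.trans ?_ (integral_add hD2 hq)
  rw [← integral_indicator (measurableSet_Ioo.inter hS)]
  refine integral_congr_ae ?_
  filter_upwards [coeFn_extendL u] with y hy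
  have hmem : y ∈ Set.Ioo a b ∩ {y : ℝ | ε < |x - y|} ↔ y ∈ Set.Ioo a b ∧ ε < |x - y| := Iff.rfl
  simp only [hy]
  by_cases h1 : y ∈ Set.Ioo a b
  · by_cases h2 : ε < |x - y|
    · rw [Set.indicator_of_mem (hmem.mpr ⟨h1, h2⟩), Set.indicator_of_mem h1, truncationError, if_pos h2]
      push_cast
      ring
    · rw [Set.indicator_of_notMem (fun h => h2 h.2), Set.indicator_of_mem h1, truncationError,
        if_neg h2]
      push_cast
      ring
  · rw [Set.indicator_of_notMem (fun h => h1 h.1), Set.indicator_of_notMem h1]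
    ring

theorem tendsto_conjPoisson {x : ℝ} (u : Lp ℂ 2 (volume : Measure ℝ))
    (hx : Tendsto (fun ε : ℝ => ∫⁻ y : ℝ, ENNReal.ofReal (ε / ((x - y) ^ 2 + ε ^ 2)) *
      ‖lineH u y - lineH u x‖ₑ) (𝓝[>] 0) (𝓝 0)) :
    Tendsto (fun ε : ℝ => ∫ y : ℝ, (((x - y) / ((x - y) ^ 2 + ε ^ 2) : ℝ) : ℂ) * u y) (𝓝[>] 0)
      (𝓝 (Complex.I * (Real.pi * lineH u x))) := by
  refine ((tendsto_integral_poisson_mul (Lp.memLp (lineH u)) hx).const_mul Complex.I).congr' ?_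
  filter_upwards [self_mem_nhdsWithin] with ε hε
  exact integral_poisson_mul_lineH x hε u

theorem isFiniteHilbertTransform_finiteH : IsFiniteHilbertTransform a b (finiteH a b) := by
  intro u
  filter_upwards [coeFn_finiteH u,
    ae_restrict_of_ae (ae_tendsto_lintegral_poisson (Lp.memLp (extendL a b u))),
    ae_restrict_of_ae (ae_tendsto_lintegral_poisson (Lp.memLp (lineH (extendL a b u))))]
    with x h1 h2 h3
  rw [h1]
  have h4 := tendsto_integral_kernel_mul_sub
    (k := fun ε t => ((truncationError ε t : ℝ) : ℂ)) h2 (fun ε hε t => by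
      rw [Complex.norm_real]; exact abs_truncationError_le hε t)
  have h5 := (h4.add (tendsto_conjPoisson _ h3)).const_mul (1 / (Complex.I * Real.pi))
  have h6 : 1 / (Complex.I * Real.pi) *
      (0 + Complex.I * (Real.pi * lineH (extendL a b u) x)) = lineH (extendL a b u) x := by
    have : (Real.pi : ℂ) ≠ 0 := by exact_mod_cast Real.pi_ne_zero
    have := Complex.I_ne_zero
    field_simp
    ring
  rw [h6] at h5
  refine h5.congr' ?_
  filter_upwards [self_mem_nhdsWithin] with ε hε
  exact (truncatedIntegral_eq u hε x _).symm

/-- The finite Hilbert transform as the boundary value of Cauchy integrals. -/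
theorem ae_tendsto_cauchyIntegral (u : L2 a b) :
    ∀ᵐ x : ℝ ∂(volume.restrict (Set.Ioo a b)), Tendsto (fun ε : ℝ =>
      (∫ y in Set.Ioo a b, 1 / ((x : ℂ) - y - Complex.I * ε) * u y) +
        ∫ y in Set.Ioo a b, 1 / ((x : ℂ) - y + Complex.I * ε) * u y) (𝓝[>] 0)
      (𝓝 (2 * Complex.I * Real.pi * finiteH a b u x)) := by
  filter_upwards [coeFn_finiteH u,
    ae_restrict_of_ae (ae_tendsto_lintegral_poisson (Lp.memLp (lineH (extendL a b u))))]
    with x h1 h3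
  rw [h1]
  have h5 := (tendsto_conjPoisson _ h3).const_mul 2
  rw [show 2 * Complex.I * Real.pi * lineH (extendL a b u) x =
    2 * (Complex.I * (Real.pi * lineH (extendL a b u) x)) by ring]
  refine h5.congr' ?_
  filter_upwards [self_mem_nhdsWithin] with ε hε
  have hε' : (0 : ℝ) < ε := hε
  rw [← integral_mul_extendL (fun y => 1 / ((x : ℂ) - y - Complex.I * ε)),
    ← integral_mul_extendL (fun y => 1 / ((x : ℂ) - y + Complex.I * ε)),
    ← integral_add (integrable_cauchy_mul' x hε'.ne' (Lp.memLp _))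
      (integrable_cauchy_mul x hε'.ne' (Lp.memLp _)), ← integral_const_mul]
  congr 1
  funext y
  have := cauchy_add_cauchy (x - y) hε'.ne'
  push_cast at this ⊢
  rw [← add_mul, this]
  ring

end FiniteTransform

/-! ### The Stieltjes transform of a power. -/

section Stieltjes

theorem exists_pos_le_norm_add {s : ℂ} (hs : s ∈ Complex.slitPlane) :
    ∃ d : ℝ, 0 < d ∧ ∀ t : ℝ, 0 ≤ t → d ≤ ‖s + t‖ := by
  rcases Complex.mem_slitPlane_iff.mp hs with h | h
  · refine ⟨s.re, h, fun t ht => ?_⟩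
    refine le_trans ?_ (Complex.re_le_norm _)
    simpa using ht
  · refine ⟨|s.im|, abs_pos.mpr h, fun t _ => ?_⟩
    have := Complex.abs_im_le_norm (s + t)
    simpa using this

/-- A bound uniform for `s` near `s₀`, needed to dominate the integrand and its derivative in `s`
when differentiating under the integral. -/
theorem exists_ball_mul_le_norm_add {s₀ : ℂ} (hs : s₀ ∈ Complex.slitPlane) :
    ∃ r : ℝ, 0 < r ∧ ∃ K : ℝ, 0 < K ∧ ∀ s ∈ Metric.ball s₀ r, ∀ t : ℝ, 0 < t →
      1 + t ≤ K * ‖s + t‖ := by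
  obtain ⟨d, hd, h⟩ := exists_pos_le_norm_add hs
  refine ⟨d / 2, by positivity, 2 * (1 + (1 + ‖s₀‖) / d), by positivity, fun s hs t ht => ?_⟩
  have h1 : ‖s₀ + t‖ ≤ ‖s + t‖ + ‖s₀ - s‖ := by
    have := norm_add_le (s + t) (s₀ - s)
    rwa [show s + t + (s₀ - s) = s₀ + t by ring] at this
  have h2 : ‖s₀ - s‖ < d / 2 := by
    rw [← dist_eq_norm, dist_comm]; exact hs
  have h3 := h t ht.le
  have h4 : t ≤ ‖s₀ + t‖ + ‖s₀‖ := by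
    have := norm_sub_le (s₀ + t) s₀
    rw [add_sub_cancel_left, Complex.norm_real, Real.norm_of_nonneg ht.le] at this
    exact this
  have h5 : (1 + ‖s₀‖) ≤ (1 + ‖s₀‖) / d * ‖s₀ + t‖ := by
    rw [div_mul_eq_mul_div, le_div_iff₀ hd]
    gcongr
  have h6 : ‖s₀ + t‖ ≤ 2 * ‖s + t‖ := by linarith
  have h7 : 1 + t ≤ (1 + (1 + ‖s₀‖) / d) * ‖s₀ + t‖ := by linarith
  calc 1 + t ≤ (1 + (1 + ‖s₀‖) / d) * ‖s₀ + t‖ := h7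
    _ ≤ (1 + (1 + ‖s₀‖) / d) * (2 * ‖s + t‖) := by gcongr
    _ = _ := by ring

theorem integrableOn_rpow_div_one_add {ρ : ℝ} (h1 : -1 < ρ) (h2 : ρ < 0) :
    IntegrableOn (fun t : ℝ => t ^ ρ / (1 + t)) (Set.Ioi 0) := by
  have hm : ∀ S : Set ℝ, AEStronglyMeasurable (fun t : ℝ => t ^ ρ / (1 + t)) (volume.restrict S) :=
    fun S => Measurable.aestronglyMeasurable (by fun_prop)
  rw [← Set.Ioo_union_Ici_eq_Ioi (zero_lt_one' ℝ)]
  refine IntegrableOn.union ?_ ?_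
  · refine Integrable.mono' ((intervalIntegral.integrableOn_Ioo_rpow_iff one_pos).mpr h1) (hm _) ?_
    filter_upwards [ae_restrict_mem measurableSet_Ioo] with t ht
    rw [Real.norm_of_nonneg (div_nonneg (Real.rpow_nonneg ht.1.le _) (by linarith [ht.1]))]
    exact div_le_self (Real.rpow_nonneg ht.1.le _) (by linarith [ht.1])
  · rw [integrableOn_Ici_iff_integrableOn_Ioi]
    refine Integrable.mono' (integrableOn_Ioi_rpow_of_lt (a := ρ - 1) (by linarith) one_pos) (hm _) ?_
    filter_upwards [ae_restrict_mem measurableSet_Ioi] with t ht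
    have ht' : (0 : ℝ) < t := zero_lt_one.trans ht
    rw [Real.norm_of_nonneg (by positivity), Real.rpow_sub_one ht'.ne']
    gcongr
    linarith

variable {γ : ℂ}

theorem measurable_cpow_ofReal (γ : ℂ) : Measurable fun t : ℝ => (t : ℂ) ^ γ :=
  Complex.measurable_ofReal.pow_const γ

/-- The Stieltjes transform of a power. -/
def stieltjes (γ s : ℂ) : ℂ := ∫ t in Set.Ioi (0 : ℝ), (t : ℂ) ^ γ / (s + t)

theorem norm_cpow_div_le {s : ℂ} {K : ℝ} {t : ℝ} (ht : 0 < t) (h : 1 + t ≤ K * ‖s + t‖) :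
    ‖(t : ℂ) ^ γ / (s + t)‖ ≤ K * (t ^ γ.re / (1 + t)) := by
  have hp : 0 < ‖s + t‖ := by
    rcases (norm_nonneg (s + t)).eq_or_lt with h0 | h0
    · rw [← h0] at h; linarith
    · exact h0
  rw [norm_div, Complex.norm_cpow_eq_rpow_re_of_pos ht, ← mul_div_assoc,
    div_le_div_iff₀ hp (by positivity)]
  have : 0 ≤ t ^ γ.re := by positivity
  nlinarith [mul_le_mul_of_nonneg_left h this]

theorem integrableOn_cpow_div (h1 : -1 < γ.re) (h2 : γ.re < 0) {s : ℂ} (hs : s ∈ Complex.slitPlane) :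
    IntegrableOn (fun t : ℝ => (t : ℂ) ^ γ / (s + t)) (Set.Ioi 0) := by
  obtain ⟨r, hr, K, hK, h⟩ := exists_ball_mul_le_norm_add hs
  refine Integrable.mono' ((integrableOn_rpow_div_one_add h1 h2).const_mul K) ?_ ?_
  · exact ((measurable_cpow_ofReal γ).div (by fun_prop)).aestronglyMeasurable
  · filter_upwards [ae_restrict_mem measurableSet_Ioi] with t ht
    exact norm_cpow_div_le ht (h s (Metric.mem_ball_self hr) t ht)

theorem differentiableOn_stieltjes (h1 : -1 < γ.re) (h2 : γ.re < 0) :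
    DifferentiableOn ℂ (stieltjes γ) Complex.slitPlane := by
  intro s₀ hs
  obtain ⟨r, hr, K, hK, h⟩ := exists_ball_mul_le_norm_add hs
  have hm : ∀ s : ℂ, AEStronglyMeasurable (fun t : ℝ => (t : ℂ) ^ γ / (s + t))
      (volume.restrict (Set.Ioi 0)) := fun s =>
    ((measurable_cpow_ofReal γ).div (by fun_prop)).aestronglyMeasurable
  have := hasDerivAt_integral_of_dominated_loc_of_deriv_le (μ := volume.restrict (Set.Ioi (0 : ℝ)))
    (F := fun (s : ℂ) (t : ℝ) => (t : ℂ) ^ γ / (s + t))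
    (F' := fun (s : ℂ) (t : ℝ) => -((t : ℂ) ^ γ / (s + t) ^ 2))
    (bound := fun t => K ^ 2 * (t ^ γ.re / (1 + t)))
    (Metric.ball_mem_nhds s₀ hr) (Eventually.of_forall hm) (integrableOn_cpow_div h1 h2 hs)
    (((measurable_cpow_ofReal γ).div (by fun_prop)).neg.aestronglyMeasurable) ?_
    ((integrableOn_rpow_div_one_add h1 h2).const_mul _) ?_
  · exact this.2.differentiableAt.differentiableWithinAt
  · filter_upwards [ae_restrict_mem measurableSet_Ioi] with t ht s hs
    have ht' : (0 : ℝ) < t := ht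
    have h3 := h s hs t ht
    have h4 : 1 ≤ K * ‖s + t‖ := by linarith
    have hp : 0 < ‖s + t‖ := by
      rcases (norm_nonneg (s + t)).eq_or_lt with h0 | h0
      · rw [← h0] at h3; linarith
      · exact h0
    rw [norm_neg, sq (s + t), ← div_div, norm_div, div_le_iff₀ hp]
    have h5 := norm_cpow_div_le (γ := γ) ht h3
    have h6 : 0 ≤ K * (t ^ γ.re / (1 + t)) := by positivity
    calc _ ≤ K * (t ^ γ.re / (1 + t)) := h5
      _ ≤ K * (t ^ γ.re / (1 + t)) * (K * ‖s + t‖) := le_mul_of_one_le_right h6 h4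
      _ = _ := by ring
  · filter_upwards [ae_restrict_mem measurableSet_Ioi] with t ht s hs
    have ht' : (0 : ℝ) < t := ht
    have h3 := h s hs t ht
    have hne : s + t ≠ 0 := by
      intro h0; rw [h0, norm_zero] at h3; linarith
    have h7 : HasDerivAt (fun s : ℂ => s + t) 1 s := (hasDerivAt_id s).add_const _
    refine ((h7.inv hne).const_mul ((t : ℂ) ^ γ)).congr_deriv ?_
    ring

/-- Homogeneity: substitute `s t` for `t`. -/
theorem stieltjes_of_pos {s : ℝ} (hs : 0 < s) :
    stieltjes γ s = stieltjes γ 1 * (s : ℂ) ^ γ := by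
  have h := integral_comp_mul_left_Ioi (fun t : ℝ => (t : ℂ) ^ γ / ((s : ℂ) + t)) 0 hs
  rw [mul_zero] at h
  have hs' : (s : ℂ) ≠ 0 := by exact_mod_cast hs.ne'
  have h2 : stieltjes γ s = s * ∫ t in Set.Ioi (0 : ℝ), ((s * t : ℝ) : ℂ) ^ γ / ((s : ℂ) + (s * t : ℝ)) := by
    rw [h, Complex.real_smul]
    unfold stieltjes
    push_cast
    rw [← mul_assoc, mul_inv_cancel₀ hs', one_mul]
  rw [h2]
  unfold stieltjes
  rw [← integral_const_mul, ← integral_mul_const]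
  refine setIntegral_congr_fun measurableSet_Ioi fun t ht => ?_
  have ht' : (0 : ℝ) < t := ht
  have h3 : (1 : ℂ) + t ≠ 0 := by
    have : (1 : ℝ) + t ≠ 0 := by positivity
    exact_mod_cast this
  push_cast
  rw [Complex.mul_cpow_ofReal_nonneg hs.le ht'.le, show (s : ℂ) + s * t = s * (1 + t) by ring]
  field_simp

/-- Identity theorem on the connected slit plane: both sides are analytic and agree at the positive
reals, which accumulate at 1. -/
theorem stieltjes_eq (h1 : -1 < γ.re) (h2 : γ.re < 0) {s : ℂ} (hs : s ∈ Complex.slitPlane) :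
    stieltjes γ s = stieltjes γ 1 * s ^ γ := by
  have hA : AnalyticOnNhd ℂ (stieltjes γ) Complex.slitPlane :=
    (differentiableOn_stieltjes h1 h2).analyticOnNhd Complex.isOpen_slitPlane
  have hB : AnalyticOnNhd ℂ (fun s : ℂ => stieltjes γ 1 * s ^ γ) Complex.slitPlane := by
    refine DifferentiableOn.analyticOnNhd (fun s hs => ?_) Complex.isOpen_slitPlane
    exact (((differentiableAt_id).cpow_const hs).const_mul _).differentiableWithinAt
  refine hA.eqOn_of_preconnected_of_frequently_eq hB
    (Complex.starConvex_one_slitPlane.isPathConnected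
      Complex.one_mem_slitPlane).isConnected.isPreconnected Complex.one_mem_slitPlane ?_ hs
  have hev : ∀ᶠ x : ℝ in 𝓝[≠] 1, stieltjes γ x = stieltjes γ 1 * (x : ℂ) ^ γ := by
    filter_upwards [mem_nhdsWithin_of_mem_nhds (Ioi_mem_nhds (zero_lt_one' ℝ))] with x hx
    exact stieltjes_of_pos hx
  have ht : Tendsto (fun x : ℝ => (x : ℂ)) (𝓝[≠] 1) (𝓝[≠] 1) := by
    refine tendsto_nhdsWithin_of_tendsto_nhds_of_eventually_within _ ?_ ?_
    · have := Complex.continuous_ofReal.tendsto 1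
      rw [Complex.ofReal_one] at this
      exact this.mono_left nhdsWithin_le_nhds
    · filter_upwards [self_mem_nhdsWithin] with x hx
      intro h
      exact hx (Complex.ofReal_eq_one.mp h)
  exact ht.frequently hev.frequently

end Stieltjes

/-! ### Transport from the half-line to the interval; the Beta integral. -/

section ChangeOfVariables

variable {a b : ℝ}

/-- The fractional linear map taking `(0, ∞)` to `(a, b)`. -/
def moebius (a b t : ℝ) : ℝ := (a + b * t) / (1 + t)

theorem hasDerivAt_moebius {t : ℝ} (ht : 0 < t) :
    HasDerivAt (moebius a b) ((b - a) / (1 + t) ^ 2) t := by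
  have h1 : HasDerivAt (fun t : ℝ => a + b * t) b t := by
    simpa using ((hasDerivAt_id t).const_mul b).const_add a
  have h2 : HasDerivAt (fun t : ℝ => 1 + t) 1 t := by
    simpa using (hasDerivAt_id t).const_add 1
  refine (h1.div h2 (by positivity)).congr_deriv ?_
  ring

theorem moebius_sub_left {t : ℝ} (ht : 0 < t) : moebius a b t - a = (b - a) * t / (1 + t) := by
  unfold moebius; field_simp; ring

theorem sub_moebius_right {t : ℝ} (ht : 0 < t) : b - moebius a b t = (b - a) / (1 + t) := by
  unfold moebius; field_simp; ring

theorem moebius_ratio (hab : a < b) {t : ℝ} (ht : 0 < t) :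
    (moebius a b t - a) / (b - moebius a b t) = t := by
  have : b - a ≠ 0 := by linarith
  rw [moebius_sub_left ht, sub_moebius_right ht]
  field_simp

theorem image_moebius (hab : a < b) : moebius a b '' Set.Ioi 0 = Set.Ioo a b := by
  ext y
  constructor
  · rintro ⟨t, ht, rfl⟩
    have ht' : (0 : ℝ) < t := ht
    have h0 : 0 < b - a := by linarith
    have h1 : 0 < moebius a b t - a := by rw [moebius_sub_left ht]; positivity
    have h2 : 0 < b - moebius a b t := by rw [sub_moebius_right ht]; positivity
    exact ⟨by linarith, by linarith⟩
  · rintro ⟨h1, h2⟩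
    have h3 : 0 < b - y := by linarith
    have h4 : 0 < y - a := by linarith
    have h5 : b - a ≠ 0 := by linarith
    refine ⟨(y - a) / (b - y), div_pos h4 h3, ?_⟩
    unfold moebius
    field_simp
    rw [show b - y + (y - a) = b - a by ring]
    ring

theorem injOn_moebius (hab : a < b) : Set.InjOn (moebius a b) (Set.Ioi 0) := by
  intro s hs t ht h
  rw [← moebius_ratio hab hs, ← moebius_ratio hab ht, h]

theorem integral_Ioo_eq_integral_Ioi (hab : a < b) {F : Type*} [NormedAddCommGroup F]
    [NormedSpace ℝ F] (f : ℝ → F) :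
    ∫ y in Set.Ioo a b, f y = ∫ t in Set.Ioi (0 : ℝ), ((b - a) / (1 + t) ^ 2) • f (moebius a b t) := by
  rw [← image_moebius hab, integral_image_eq_integral_abs_deriv_smul measurableSet_Ioi
    (fun t ht => (hasDerivAt_moebius ht).hasDerivWithinAt) (injOn_moebius hab)]
  refine setIntegral_congr_fun measurableSet_Ioi fun t ht => ?_
  have : 0 ≤ (b - a) / (1 + t) ^ 2 := div_nonneg (by linarith) (by positivity)
  simp only [abs_of_nonneg this]

theorem integrableOn_Ioo_iff_integrableOn_Ioi (hab : a < b) {F : Type*} [NormedAddCommGroup F]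
    [NormedSpace ℝ F] (f : ℝ → F) :
    IntegrableOn f (Set.Ioo a b) ↔
      IntegrableOn (fun t : ℝ => ((b - a) / (1 + t) ^ 2) • f (moebius a b t)) (Set.Ioi 0) := by
  rw [← image_moebius hab, integrableOn_image_iff_integrableOn_abs_deriv_smul measurableSet_Ioi
    (fun t ht => (hasDerivAt_moebius ht).hasDerivWithinAt) (injOn_moebius hab)]
  refine integrableOn_congr_fun (fun t ht => ?_) measurableSet_Ioi
  have : 0 ≤ (b - a) / (1 + t) ^ 2 := div_nonneg (by linarith) (by positivity)
  simp only [abs_of_nonneg this]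

/-- The substitution `moebius 0 1` turns the Beta integral `B(γ + 1, -γ)` into this one, and Euler's
reflection formula evaluates it. -/
theorem stieltjes_one {γ : ℂ} (h1 : -1 < γ.re) (h2 : γ.re < 0) :
    stieltjes γ 1 = -Real.pi / Complex.sin (Real.pi * γ) := by
  have hb := Complex.Gamma_mul_Gamma_eq_betaIntegral (s := γ + 1) (t := -γ)
    (by simp; linarith) (by simp; linarith)
  rw [show γ + 1 + -γ = 1 by ring, Complex.Gamma_one, one_mul] at hb
  have hr := Complex.Gamma_mul_Gamma_one_sub (-γ)
  rw [show 1 - -γ = γ + 1 by ring, mul_comm, hb, mul_neg, Complex.sin_neg] at hr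
  rw [neg_div, ← div_neg, ← hr]
  unfold stieltjes Complex.betaIntegral
  rw [intervalIntegral.integral_of_le zero_le_one, integral_Ioc_eq_integral_Ioo,
    integral_Ioo_eq_integral_Ioi zero_lt_one]
  refine setIntegral_congr_fun measurableSet_Ioi fun t ht => ?_
  have ht' : (0 : ℝ) < t := ht
  have h3 : (0 : ℝ) < 1 + t := by positivity
  have h4 : moebius 0 1 t = t * (1 + t)⁻¹ := by unfold moebius; field_simp; ring
  have h5 : (1 : ℂ) - (moebius 0 1 t : ℝ) = ((1 + t)⁻¹ : ℝ) := by
    rw [h4, ← Complex.ofReal_one, ← Complex.ofReal_sub]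
    congr 1
    field_simp; ring
  have h6 : ((1 + t : ℝ) : ℂ) ≠ 0 := by exact_mod_cast h3.ne'
  have h7 : (((1 + t)⁻¹ : ℝ) : ℂ) ≠ 0 := by exact_mod_cast (inv_pos.mpr h3).ne'
  rw [h5, h4, add_sub_cancel_right, Complex.ofReal_mul,
    Complex.mul_cpow_ofReal_nonneg ht'.le (inv_pos.mpr h3).le, mul_assoc, ← Complex.cpow_add _ _ h7,
    show γ + (-γ - 1) = -1 by ring, Complex.cpow_neg_one, Complex.real_smul]
  push_cast at h6 ⊢
  field_simp
  ring

end ChangeOfVariables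

/-! ### Power functions as approximate eigenfunctions of `finiteH`. -/

section PowerFunctions

variable {a b : ℝ} {γ : ℂ}

/-- The function `((y - a) / (b - y)) ^ γ`, a generalized eigenfunction up to constants. -/
def powerFun (a b : ℝ) (γ : ℂ) (y : ℝ) : ℂ := (((y - a) / (b - y) : ℝ) : ℂ) ^ γ

theorem measurable_powerFun : Measurable (powerFun a b γ) :=
  (measurable_cpow_ofReal γ).comp (by fun_prop : Measurable fun y : ℝ => (y - a) / (b - y))

theorem powerFun_moebius (hab : a < b) {t : ℝ} (ht : 0 < t) :
    powerFun a b γ (moebius a b t) = (t : ℂ) ^ γ := by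
  unfold powerFun
  rw [moebius_ratio hab ht]

theorem norm_powerFun_moebius_sq (hab : a < b) {t : ℝ} (ht : 0 < t) :
    ‖powerFun a b γ (moebius a b t)‖ ^ 2 = t ^ (2 * γ.re) := by
  rw [powerFun_moebius hab ht, Complex.norm_cpow_eq_rpow_re_of_pos ht, mul_comm,
    Real.rpow_mul ht.le, Real.rpow_two]

theorem integrableOn_moebius_weight_rpow (hab : a < b) {ρ : ℝ} (h1 : -1 < ρ) (h2 : ρ < 0) :
    IntegrableOn (fun t : ℝ => (b - a) / (1 + t) ^ 2 * t ^ ρ) (Set.Ioi 0) := by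
  have h0 : 0 < b - a := by linarith
  refine Integrable.mono' ((integrableOn_rpow_div_one_add h1 h2).const_mul (b - a))
    (Measurable.aestronglyMeasurable (by fun_prop)) ?_
  filter_upwards [ae_restrict_mem measurableSet_Ioi] with t ht
  have ht' : (0 : ℝ) < t := ht
  rw [Real.norm_of_nonneg (by positivity), div_mul_eq_mul_div, mul_div_assoc]
  gcongr
  nlinarith

theorem memLp_powerFun (hab : a < b) (h1 : -1 / 2 < γ.re) (h2 : γ.re < 0) :
    MemLp (powerFun a b γ) 2 (volume.restrict (Set.Ioo a b)) := by
  rw [memLp_two_iff_integrable_sq_norm measurable_powerFun.aestronglyMeasurable]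
  change IntegrableOn (fun y => ‖powerFun a b γ y‖ ^ 2) (Set.Ioo a b) volume
  rw [integrableOn_Ioo_iff_integrableOn_Ioi hab]
  refine (integrableOn_moebius_weight_rpow hab (ρ := 2 * γ.re) (by linarith) (by linarith)).congr_fun
    (fun t ht => ?_) measurableSet_Ioi
  simp only
  rw [norm_powerFun_moebius_sq hab ht, smul_eq_mul]

/-- The norm blows up as `Re γ` decreases to `-1/2`. Only `0 < t < 1` is kept, where the Jacobian is
at least `(b - a) / 4`. -/
theorem le_integral_norm_powerFun_sq (hab : a < b) (h1 : -1 / 2 < γ.re) (h2 : γ.re < 0) :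
    (b - a) / 4 * (1 / (2 * γ.re + 1)) ≤ ∫ y in Set.Ioo a b, ‖powerFun a b γ y‖ ^ 2 := by
  have h0 : 0 < b - a := by linarith
  have hI := integrableOn_moebius_weight_rpow hab (ρ := 2 * γ.re) (by linarith) (by linarith)
  rw [integral_Ioo_eq_integral_Ioi hab, setIntegral_congr_fun (g := fun t : ℝ =>
    (b - a) / (1 + t) ^ 2 * t ^ (2 * γ.re)) measurableSet_Ioi (fun t ht => by
      simp only
      rw [norm_powerFun_moebius_sq hab ht, smul_eq_mul])]
  have hsub : Set.Ioo (0 : ℝ) 1 ⊆ Set.Ioi 0 := Set.Ioo_subset_Ioi_self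
  refine le_trans ?_ (setIntegral_mono_set hI ?_ hsub.eventuallyLE)
  · have h3 : ∫ t in Set.Ioo (0 : ℝ) 1, (b - a) / 4 * t ^ (2 * γ.re) =
        (b - a) / 4 * (1 / (2 * γ.re + 1)) := by
      rw [integral_const_mul, ← integral_Ioc_eq_integral_Ioo,
        ← intervalIntegral.integral_of_le zero_le_one, integral_rpow (Or.inl (by linarith)),
        Real.one_rpow, Real.zero_rpow (by linarith), sub_zero]
    rw [← h3]
    refine setIntegral_mono_on ?_ (hI.mono_set hsub) measurableSet_Ioo fun t ht => ?_
    · exact ((intervalIntegral.integrableOn_Ioo_rpow_iff one_pos).mpr (by linarith)).const_mul _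
    · have ht0 := ht.1
      have ht1 := ht.2
      have : 0 ≤ t ^ (2 * γ.re) := Real.rpow_nonneg ht0.le _
      gcongr
      nlinarith
  · filter_upwards [ae_restrict_mem measurableSet_Ioi] with t ht
    have ht' : (0 : ℝ) < t := ht
    simp only [Pi.zero_apply]
    positivity

theorem cauchy_ratio_im {z : ℂ} (hz : z.im ≠ 0) :
    ((z - a) / (z - b)).im = -(b - a) * z.im / Complex.normSq (z - b) := by
  have hne : Complex.normSq (z - b) ≠ 0 := by
    rw [Ne, Complex.normSq_eq_zero]
    intro h
    have := congrArg Complex.im h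
    simp at this
    exact hz this
  rw [Complex.div_im]
  field_simp
  simp
  ring

/-- With `s = (z - a) / (z - b)`, the Möbius substitution and partial fractions turn the Cauchy
kernel with its Jacobian into `1 / (1 + t) - 1 / (s + t)`, a difference of two Stieltjes kernels. -/
theorem integral_cauchy_powerFun (hab : a < b) (h1 : -1 < γ.re) (h2 : γ.re < 0) {z : ℂ}
    (hz : z.im ≠ 0) :
    ∫ y in Set.Ioo a b, 1 / (z - y) * powerFun a b γ y =
      stieltjes γ 1 * (1 - ((z - a) / (z - b)) ^ γ) := by
  have him : ((z - a) / (z - b)).im ≠ 0 := by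
    rw [cauchy_ratio_im hz]
    refine div_ne_zero (mul_ne_zero (by linarith) hz) ?_
    rw [Ne, Complex.normSq_eq_zero]
    intro h
    have := congrArg Complex.im h
    simp at this
    exact hz this
  have hs : (z - a) / (z - b) ∈ Complex.slitPlane := Complex.mem_slitPlane_iff.mpr (Or.inr him)
  rw [mul_sub, mul_one, ← stieltjes_eq h1 h2 hs]
  unfold stieltjes
  rw [← integral_sub (integrableOn_cpow_div h1 h2 Complex.one_mem_slitPlane)
    (integrableOn_cpow_div h1 h2 hs), integral_Ioo_eq_integral_Ioi hab]
  refine setIntegral_congr_fun measurableSet_Ioi fun t ht => ?_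
  have ht' : (0 : ℝ) < t := ht
  have hzb : z - b ≠ 0 := by
    intro h
    have := congrArg Complex.im h
    simp at this
    exact hz this
  have h3 : (1 : ℂ) + t ≠ 0 := by
    have : (1 : ℝ) + t ≠ 0 := by positivity
    exact_mod_cast this
  have h4 : (z - a) / (z - b) + t ≠ 0 := by
    intro h
    have := congrArg Complex.im h
    simp only [Complex.add_im, Complex.ofReal_im, add_zero, Complex.zero_im] at this
    exact him this
  have h5 : (z - a) + (z - b) * t ≠ 0 := by
    intro h
    apply h4
    rw [div_add' _ _ _ hzb, mul_comm (t : ℂ), h, zero_div]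
  have h6 : z - (moebius a b t : ℝ) = ((z - a) + (z - b) * t) / (1 + t) := by
    unfold moebius
    push_cast
    field_simp
    ring
  have h7 : (z - a) / (z - b) + t = ((z - a) + (z - b) * t) / (z - b) := by
    field_simp
  rw [powerFun_moebius hab ht', h6, h7, Complex.real_smul]
  obtain ⟨D, hD⟩ : ∃ D, D = z - a + (z - b) * t := ⟨_, rfl⟩
  rw [← hD] at h5 ⊢
  push_cast
  field_simp
  rw [hD]
  ring

/-- The ratio tends to a negative real number, on the branch cut. The half-plane `S` from which it
approaches decides the limit of the logarithm, recorded by `θ = ±πi`. -/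
theorem tendsto_cauchy_ratio_cpow (s : ℝ) {x : ℝ} (hx : x ∈ Set.Ioo a b) (θ : ℂ)
    {S : Set ℂ} (hS : ∀ ε : ℝ, 0 < ε →
      ((x : ℂ) + s * Complex.I * ε - a) / ((x : ℂ) + s * Complex.I * ε - b) ∈ S)
    (hS0 : ∀ ε : ℝ, 0 < ε →
      ((x : ℂ) + s * Complex.I * ε - a) / ((x : ℂ) + s * Complex.I * ε - b) ≠ 0)
    (hlog : Tendsto Complex.log (𝓝[S] (((x - a) / (x - b) : ℝ) : ℂ))
      (𝓝 (Real.log ‖(((x - a) / (x - b) : ℝ) : ℂ)‖ + θ))) :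
    Tendsto (fun ε : ℝ => (((x : ℂ) + s * Complex.I * ε - a) /
      ((x : ℂ) + s * Complex.I * ε - b)) ^ γ) (𝓝[>] 0)
      (𝓝 (powerFun a b γ x * Complex.exp (θ * γ))) := by
  have h1 : 0 < x - a := by linarith [hx.1]
  have h2 : x - b < 0 := by linarith [hx.2]
  have hxb : (x : ℂ) - b ≠ 0 := by
    rw [← Complex.ofReal_sub]; exact_mod_cast h2.ne
  have hc : Tendsto (fun ε : ℝ => ((x : ℂ) + s * Complex.I * ε - a) /
      ((x : ℂ) + s * Complex.I * ε - b)) (𝓝[>] 0) (𝓝[S] (((x - a) / (x - b) : ℝ) : ℂ)) := by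
    refine tendsto_nhdsWithin_of_tendsto_nhds_of_eventually_within _ ?_ ?_
    · have : ContinuousAt (fun ε : ℝ => ((x : ℂ) + s * Complex.I * ε - a) /
          ((x : ℂ) + s * Complex.I * ε - b)) 0 := by
        refine ContinuousAt.div (by fun_prop) (by fun_prop) ?_
        simpa using hxb
      have h3 := this.tendsto.mono_left (nhdsWithin_le_nhds (s := Set.Ioi 0))
      simpa using h3
    · filter_upwards [self_mem_nhdsWithin] with ε hε
      exact hS ε hε
  have h3 := (((hlog.comp hc).mul_const γ).cexp)
  have hpos : 0 < (x - a) / (b - x) := div_pos h1 (by linarith)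
  have h4 : Complex.exp ((Real.log ‖(((x - a) / (x - b) : ℝ) : ℂ)‖ + θ) * γ) =
      powerFun a b γ x * Complex.exp (θ * γ) := by
    have h5 : ‖(((x - a) / (x - b) : ℝ) : ℂ)‖ = (x - a) / (b - x) := by
      rw [Complex.norm_real, Real.norm_eq_abs, abs_div, abs_of_pos h1, abs_of_neg h2, neg_sub]
    rw [h5, powerFun, Complex.cpow_def_of_ne_zero (by exact_mod_cast hpos.ne'),
      ← Complex.ofReal_log hpos.le, ← Complex.exp_add]
    congr 1
    ring
  rw [h4] at h3
  refine h3.congr' ?_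
  filter_upwards [self_mem_nhdsWithin] with ε hε
  rw [Complex.cpow_def_of_ne_zero (hS0 ε hε)]
  rfl

/-- The power function as an element of `L²(Ω)`. -/
def powerL2 (hab : a < b) (h1 : -1 / 2 < γ.re) (h2 : γ.re < 0) : L2 a b :=
  (memLp_powerFun hab h1 h2).toLp _

theorem coeFn_powerL2 (hab : a < b) (h1 : -1 / 2 < γ.re) (h2 : γ.re < 0) :
    powerL2 hab h1 h2 =ᵐ[volume.restrict (Set.Ioo a b)] powerFun a b γ :=
  MemLp.coeFn_toLp _

/-- The boundary values of the Cauchy integral from the two sides carry the factors `exp (±πiγ)`;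
their sum gives `2 cos(πγ)`. -/
theorem finiteH_powerL2 (hab : a < b) (h1 : -1 / 2 < γ.re) (h2 : γ.re < 0) :
    finiteH a b (powerL2 hab h1 h2) =ᵐ[volume.restrict (Set.Ioo a b)] fun x =>
      stieltjes γ 1 / (Complex.I * Real.pi) * (1 - Complex.cos (Real.pi * γ) * powerFun a b γ x) := by
  filter_upwards [ae_tendsto_cauchyIntegral (powerL2 hab h1 h2),
    ae_restrict_mem measurableSet_Ioo] with x hlim hx
  have hint : ∀ z : ℂ, z.im ≠ 0 → ∫ y in Set.Ioo a b, 1 / (z - y) * powerL2 hab h1 h2 y =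
      stieltjes γ 1 * (1 - ((z - a) / (z - b)) ^ γ) := fun z hz => by
    rw [← integral_cauchy_powerFun hab (by linarith) h2 hz]
    refine integral_congr_ae ?_
    filter_upwards [coeFn_powerL2 hab h1 h2] with y hy
    rw [hy]
  have hx1 : 0 < x - a := by linarith [hx.1]
  have hx2 : x - b < 0 := by linarith [hx.2]
  have hneg : (x - a) / (x - b) < 0 := div_neg_of_pos_of_neg hx1 hx2
  have him : ∀ s ε : ℝ, ((x : ℂ) + s * Complex.I * ε).im = s * ε := fun s ε => by simp
  have hsgn : ∀ s ε : ℝ, s ≠ 0 → 0 < ε → ((((x : ℂ) + s * Complex.I * ε - a) /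
      ((x : ℂ) + s * Complex.I * ε - b)).im = -(b - a) * (s * ε) /
        Complex.normSq ((x : ℂ) + s * Complex.I * ε - b)) ∧
      0 < Complex.normSq ((x : ℂ) + s * Complex.I * ε - b) := fun s ε hs hε => by
    have h3 : ((x : ℂ) + s * Complex.I * ε).im ≠ 0 := by
      rw [him]; exact mul_ne_zero hs hε.ne'
    refine ⟨by rw [cauchy_ratio_im h3, him], Complex.normSq_pos.mpr fun h => ?_⟩
    have := congrArg Complex.im h
    rw [Complex.sub_im, him] at this
    simp at this
    rcases this with h | h
    · exact hs h
    · exact hε.ne' h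
  have hba : 0 < b - a := by linarith
  have hne : ∀ s ε : ℝ, s ≠ 0 → 0 < ε → ((x : ℂ) + s * Complex.I * ε - a) /
      ((x : ℂ) + s * Complex.I * ε - b) ≠ 0 := fun s ε hs hε h => by
    obtain ⟨h3, h4⟩ := hsgn s ε hs hε
    rw [h, Complex.zero_im] at h3
    exact (div_ne_zero (mul_ne_zero (neg_ne_zero.mpr hba.ne') (mul_ne_zero hs hε.ne')) h4.ne') h3.symm
  -- `z ↦ (z - a) / (z - b)` exchanges the half-planes: from below `Ω` the cut is approached from
  -- above.
  have hlow := tendsto_cauchy_ratio_cpow (γ := γ) (-1) hx (Real.pi * Complex.I)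
    (S := {z : ℂ | 0 ≤ z.im}) (fun ε hε => by
      obtain ⟨h3, h4⟩ := hsgn (-1) ε (by norm_num) hε
      rw [Set.mem_ofPred_eq, h3]
      exact div_nonneg (by nlinarith) h4.le) (fun ε hε => hne (-1) ε (by norm_num) hε)
    (Complex.tendsto_log_nhdsWithin_im_nonneg_of_re_neg_of_im_zero
      (by rw [Complex.ofReal_re]; exact hneg) (Complex.ofReal_im _))
  have hup := tendsto_cauchy_ratio_cpow (γ := γ) 1 hx (-(Real.pi * Complex.I))
    (S := {z : ℂ | z.im < 0}) (fun ε hε => by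
      obtain ⟨h3, h4⟩ := hsgn 1 ε (by norm_num) hε
      rw [Set.mem_ofPred_eq, h3]
      exact div_neg_of_neg_of_pos (by nlinarith) h4) (fun ε hε => hne 1 ε (by norm_num) hε)
    (by
      rw [← sub_eq_add_neg]
      exact Complex.tendsto_log_nhdsWithin_im_neg_of_re_neg_of_im_zero
        (by rw [Complex.ofReal_re]; exact hneg) (Complex.ofReal_im _))
  have hsum := ((hlow.const_sub 1).const_mul (stieltjes γ 1)).add
    ((hup.const_sub 1).const_mul (stieltjes γ 1))
  have huniq := tendsto_nhds_unique (hlim.congr' ?_) hsum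
  · have hpi : (Real.pi : ℂ) ≠ 0 := by exact_mod_cast Real.pi_ne_zero
    have hI := Complex.I_ne_zero
    have hcos := Complex.two_cos (Real.pi * γ)
    have e1 : (Real.pi : ℂ) * Complex.I * γ = Real.pi * γ * Complex.I := by ring
    have e2 : -((Real.pi : ℂ) * Complex.I) * γ = -(Real.pi * γ) * Complex.I := by ring
    rw [e1, e2] at huniq
    rw [div_mul_eq_mul_div, eq_div_iff (mul_ne_zero hI hpi)]
    apply mul_left_cancel₀ (two_ne_zero (α := ℂ))
    linear_combination huniq + stieltjes γ 1 * powerFun a b γ x * hcos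
  · filter_upwards [self_mem_nhdsWithin] with ε hε
    have hε' : (0 : ℝ) < ε := hε
    have e1 : ∀ y : ℝ, (x : ℂ) - y - Complex.I * ε = ((x : ℂ) + (-1 : ℝ) * Complex.I * ε) - y :=
      fun y => by push_cast; ring
    have e2 : ∀ y : ℝ, (x : ℂ) - y + Complex.I * ε = ((x : ℂ) + (1 : ℝ) * Complex.I * ε) - y :=
      fun y => by push_cast; ring
    simp_rw [e1, e2]
    rw [hint _ (by rw [him]; linarith), hint _ (by rw [him]; linarith)]

theorem L2_norm_sq {α : Type*} {m : MeasurableSpace α} {μ : Measure α} (u : Lp ℂ 2 μ) :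
    ‖u‖ ^ 2 = ∫ x, ‖u x‖ ^ 2 ∂μ := by
  have h := inner_self_eq_norm_sq_to_K (𝕜 := ℂ) u
  rw [L2.inner_def] at h
  simp only [inner_self_eq_norm_sq_to_K] at h
  have h2 : ∫ x, (((‖u x‖ ^ 2 : ℝ)) : ℂ) ∂μ = ((‖u‖ ^ 2 : ℝ) : ℂ) := by
    push_cast
    exact h
  rw [integral_complex_ofReal] at h2
  exact_mod_cast h2.symm

/-- The part of `finiteH` not proportional to the power function is a constant function, of norm a
multiple of `√(b - a)`. -/
theorem norm_sub_finiteH_powerL2_le (hab : a < b) (h1 : -1 / 2 < γ.re) (h2 : γ.re < 0) (lam : ℂ) :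
    ‖lam • powerL2 hab h1 h2 - finiteH a b (powerL2 hab h1 h2)‖ ≤
      ‖lam + stieltjes γ 1 / (Complex.I * Real.pi) * Complex.cos (Real.pi * γ)‖ *
        ‖powerL2 hab h1 h2‖ + ‖stieltjes γ 1 / (Complex.I * Real.pi)‖ * √(b - a) := by
  set κ := stieltjes γ 1 / (Complex.I * Real.pi) with hκ
  set U := powerL2 hab h1 h2 with hU
  have hone : MemLp (fun _ : ℝ => (1 : ℂ)) 2 (volume.restrict (Set.Ioo a b)) := memLp_const _
  have heq : lam • U - finiteH a b U =
      (lam + κ * Complex.cos (Real.pi * γ)) • U - κ • hone.toLp _ := by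
    apply Lp.ext
    filter_upwards [finiteH_powerL2 hab h1 h2, coeFn_powerL2 hab h1 h2,
      Lp.coeFn_sub (lam • U) (finiteH a b U), Lp.coeFn_smul lam U,
      Lp.coeFn_sub ((lam + κ * Complex.cos (Real.pi * γ)) • U) (κ • hone.toLp _),
      Lp.coeFn_smul (lam + κ * Complex.cos (Real.pi * γ)) U, Lp.coeFn_smul κ (hone.toLp _),
      hone.coeFn_toLp] with x e1 e2 e3 e4 e5 e6 e7 e8
    rw [e3, e5, Pi.sub_apply, Pi.sub_apply, e4, e6, e7, Pi.smul_apply, Pi.smul_apply, Pi.smul_apply,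
      e1, e8, hU, e2, ← hκ]
    simp only [smul_eq_mul]
    ring
  have hnorm : ‖hone.toLp (fun _ : ℝ => (1 : ℂ))‖ = √(b - a) := by
    rw [← Real.sqrt_sq (norm_nonneg (hone.toLp _)), L2_norm_sq]
    congr 1
    have : ∫ x in Set.Ioo a b, ‖hone.toLp (fun _ : ℝ => (1 : ℂ)) x‖ ^ 2 =
        ∫ x in Set.Ioo a b, (1 : ℝ) := by
      refine integral_congr_ae ?_
      filter_upwards [hone.coeFn_toLp] with x hx
      rw [hx]; simp
    rw [this]
    simp [hab.le]
  rw [heq]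
  refine (norm_sub_le _ _).trans ?_
  rw [norm_smul, norm_smul, hnorm]

/-- Every point of `(-1, 1)` is an approximate eigenvalue of the finite Hilbert transform. -/
theorem exists_approx_eigenvector_finiteH (hab : a < b) {lam : ℝ} (hl : lam ∈ Set.Ioo (-1 : ℝ) 1)
    {e : ℝ} (he : 0 < e) :
    ∃ u : L2 a b, u ≠ 0 ∧ ‖(lam : ℂ) • u - finiteH a b u‖ ≤ e * ‖u‖ := by
  -- At `γ = -1/2 + iσ` the factor `-i cot(πγ)` equals `tanh(-πσ)`, so this `σ` makes it `lam`. The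
  -- exponent is then shifted by `δ > 0` to stay in `L²`.
  set σ : ℝ := -Real.artanh lam / Real.pi with hσ
  have hpi := Real.pi_pos
  have hpiC : (Real.pi : ℂ) ≠ 0 := by exact_mod_cast hpi.ne'
  set g : ℝ → ℂ := fun δ => -1 / 2 + δ + σ * Complex.I with hg
  have hgre : ∀ δ, (g δ).re = -1 / 2 + δ := fun δ => by simp [hg]
  have hgc : Continuous g := by fun_prop
  have hang : (Real.pi : ℂ) * g 0 = -((Real.artanh lam : ℝ) * Complex.I + (Real.pi : ℂ) / 2) := by
    simp only [hg, hσ]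
    push_cast
    field_simp
    ring
  have hsin : Complex.sin (Real.pi * g 0) = -Complex.cosh (Real.artanh lam : ℝ) := by
    rw [hang, Complex.sin_neg, Complex.sin_add_pi_div_two, Complex.cos_mul_I]
  have hcos : Complex.cos (Real.pi * g 0) = -(Complex.sinh (Real.artanh lam : ℝ) * Complex.I) := by
    rw [hang, Complex.cos_neg, Complex.cos_add_pi_div_two, Complex.sin_mul_I]
  have hcosh : Complex.cosh (Real.artanh lam : ℝ) ≠ 0 := by
    rw [← Complex.ofReal_cosh]
    exact_mod_cast (Real.cosh_pos _).ne'
  have hsin0 : Complex.sin (Real.pi * g 0) ≠ 0 := by rw [hsin]; exact neg_ne_zero.mpr hcosh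
  set κ : ℝ → ℂ := fun δ => -Real.pi / Complex.sin (Real.pi * g δ) / (Complex.I * Real.pi) with hκ
  have hκc : ContinuousAt κ 0 := by
    have hsc : ContinuousAt (fun δ => Complex.sin (Real.pi * g δ)) 0 :=
      (Complex.continuous_sin.comp (continuous_const.mul hgc)).continuousAt
    exact (continuousAt_const.div hsc hsin0).div_const _
  have hmu : Tendsto (fun δ => ‖(lam : ℂ) + κ δ * Complex.cos (Real.pi * g δ)‖) (𝓝 0) (𝓝 0) := by
    have hc : ContinuousAt (fun δ => ‖(lam : ℂ) + κ δ * Complex.cos (Real.pi * g δ)‖) 0 := by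
      refine ContinuousAt.norm (continuousAt_const.add (hκc.mul ?_))
      exact (Complex.continuous_cos.comp (continuous_const.mul hgc)).continuousAt
    have h0 : (lam : ℂ) + κ 0 * Complex.cos (Real.pi * g 0) = 0 := by
      have htanh : Complex.sinh (Real.artanh lam : ℝ) =
          lam * Complex.cosh (Real.artanh lam : ℝ) := by
        have h1 := Real.tanh_artanh hl
        rw [Real.tanh_eq_sinh_div_cosh, div_eq_iff (Real.cosh_pos _).ne'] at h1
        rw [← Complex.ofReal_sinh, ← Complex.ofReal_cosh, h1]
        push_cast
        ring
      simp only [hκ]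
      rw [hsin, hcos, htanh]
      have := Complex.I_ne_zero
      field_simp
      ring
    have := hc.tendsto
    rwa [h0, norm_zero] at this
  have hev1 : ∀ᶠ δ in 𝓝 (0 : ℝ), ‖(lam : ℂ) + κ δ * Complex.cos (Real.pi * g δ)‖ < e / 2 :=
    hmu.eventually (gt_mem_nhds (by positivity))
  have hev2 : ∀ᶠ δ in 𝓝 (0 : ℝ), ‖κ δ‖ < ‖κ 0‖ + 1 :=
    hκc.norm.tendsto.eventually (gt_mem_nhds (by linarith))
  -- The right side bounds the squared norm from below. The square makes the constant remainder at
  -- most `e / 2` of the norm; the `+ 1` ensures `u ≠ 0`.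
  have hev3 : ∀ᶠ δ : ℝ in 𝓝[>] 0, (2 * ((‖κ 0‖ + 1) * √(b - a)) / e) ^ 2 + 1 ≤
      (b - a) / 4 * (1 / (2 * δ)) := by
    have : Tendsto (fun δ : ℝ => (b - a) / 8 * δ⁻¹) (𝓝[>] 0) atTop :=
      tendsto_inv_nhdsGT_zero.const_mul_atTop (by linarith)
    filter_upwards [this.eventually_ge_atTop _] with δ hδ
    refine hδ.trans (le_of_eq ?_)
    rw [one_div, mul_inv]; ring
  have hev4 : ∀ᶠ δ : ℝ in 𝓝[>] 0, δ < 1 / 2 := nhdsWithin_le_nhds (gt_mem_nhds (by norm_num))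
  obtain ⟨δ, d1, d2, d3, d4, d5⟩ := ((hev1.filter_mono nhdsWithin_le_nhds).and
    ((hev2.filter_mono nhdsWithin_le_nhds).and (hev3.and (hev4.and self_mem_nhdsWithin)))).exists
  have d5' : (0 : ℝ) < δ := d5
  have r1 : -1 / 2 < (g δ).re := by rw [hgre]; linarith
  have r2 : (g δ).re < 0 := by rw [hgre]; linarith
  have hst : stieltjes (g δ) 1 / (Complex.I * Real.pi) = κ δ := by
    rw [stieltjes_one (by linarith) r2]
  have hU := norm_sub_finiteH_powerL2_le hab r1 r2 lam
  rw [hst] at hU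
  have hbig : (2 * ((‖κ 0‖ + 1) * √(b - a)) / e) ^ 2 + 1 ≤ ‖powerL2 hab r1 r2‖ ^ 2 := by
    refine d3.trans ?_
    have := le_integral_norm_powerFun_sq hab r1 r2
    rw [hgre, show 2 * (-1 / 2 + δ) + 1 = 2 * δ by ring] at this
    refine this.trans (le_of_eq ?_)
    rw [L2_norm_sq]
    refine integral_congr_ae ?_
    filter_upwards [coeFn_powerL2 hab r1 r2] with x hx
    rw [hx]
  refine ⟨powerL2 hab r1 r2, ?_, ?_⟩
  · intro h
    rw [h, norm_zero] at hbig
    nlinarith [sq_nonneg (2 * ((‖κ 0‖ + 1) * √(b - a)) / e)]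
  · have hle : 2 * ((‖κ 0‖ + 1) * √(b - a)) / e ≤ ‖powerL2 hab r1 r2‖ :=
      le_of_sq_le_sq (by linarith) (norm_nonneg _)
    rw [div_le_iff₀ he] at hle
    have h3 : ‖κ δ‖ * √(b - a) ≤ (‖κ 0‖ + 1) * √(b - a) := by gcongr
    have h4 := mul_le_mul_of_nonneg_right d1.le (norm_nonneg (powerL2 hab r1 r2))
    linarith

end PowerFunctions

/-! ### Exponentials on the unit interval and the sawtooth symbol. -/

section Circle

/-- Lebesgue measure on the unit interval. -/
abbrev unitMeasure : Measure ℝ := volume.restrict (Set.Ioc (0 : ℝ) 1)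

instance isProbabilityMeasure_unitMeasure : IsProbabilityMeasure unitMeasure :=
  ⟨by simp⟩

/-- The exponential `θ ↦ exp (2πinθ)`. -/
def expFun (n : ℤ) (θ : ℝ) : ℂ := Complex.exp (2 * Real.pi * Complex.I * n * θ)

theorem continuous_expFun (n : ℤ) : Continuous (expFun n) := by
  unfold expFun
  fun_prop

theorem norm_expFun (n : ℤ) (θ : ℝ) : ‖expFun n θ‖ = 1 := by
  unfold expFun
  rw [Complex.norm_exp]
  simp

theorem memLp_expFun (n : ℤ) : MemLp (expFun n) 2 unitMeasure :=
  MemLp.of_bound (continuous_expFun n).aestronglyMeasurable 1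
    (Eventually.of_forall fun θ => (norm_expFun n θ).le)

/-- The exponentials as elements of `L²(0, 1)`. -/
def expL2 (n : ℤ) : Lp ℂ 2 unitMeasure := (memLp_expFun n).toLp _

theorem coeFn_expL2 (n : ℤ) : expL2 n =ᵐ[unitMeasure] expFun n := MemLp.coeFn_toLp _

theorem expFun_mul_conj (m n : ℤ) (θ : ℝ) :
    expFun n θ * starRingEnd ℂ (expFun m θ) = expFun (n - m) θ := by
  unfold expFun
  rw [← Complex.exp_conj, ← Complex.exp_add]
  congr 1
  simp only [map_mul, Complex.conj_I, Complex.conj_ofReal, map_intCast, map_ofNat]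
  push_cast
  ring

theorem exp_coeff_ne_zero {k : ℤ} (hk : k ≠ 0) : (2 * Real.pi * Complex.I * k : ℂ) ≠ 0 := by
  have := Real.pi_ne_zero
  have hk' : (k : ℂ) ≠ 0 := by exact_mod_cast hk
  simp [this, hk']

theorem expFun_one (k : ℤ) : expFun k 1 = 1 := by
  unfold expFun
  rw [Complex.exp_eq_one_iff]
  exact ⟨k, by push_cast; ring⟩

theorem integral_expFun (k : ℤ) : ∫ θ, expFun k θ ∂unitMeasure = if k = 0 then 1 else 0 := by
  rw [← intervalIntegral.integral_of_le zero_le_one]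
  split_ifs with hk
  · simp [expFun, hk]
  · have h := integral_exp_mul_complex (a := 0) (b := 1) (exp_coeff_ne_zero hk)
    have h1 := expFun_one k
    unfold expFun at h1 ⊢
    rw [h, h1]
    simp

theorem orthonormal_expL2 : Orthonormal ℂ expL2 := by
  rw [orthonormal_iff_ite]
  intro m n
  rw [L2.inner_def]
  have h : ∫ θ, inner ℂ (expL2 m θ) (expL2 n θ) ∂unitMeasure =
      ∫ θ, expFun (n - m) θ ∂unitMeasure := by
    refine integral_congr_ae ?_
    filter_upwards [coeFn_expL2 m, coeFn_expL2 n] with θ h1 h2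
    rw [h1, h2, RCLike.inner_apply, expFun_mul_conj]
  rw [h, integral_expFun]
  simp only [sub_eq_zero, eq_comm]

/-- The symbol of the discretized Hilbert transformation. -/
def sawtooth (θ : ℝ) : ℂ := if θ ∈ Set.Ioc (0 : ℝ) 1 then ((1 - 2 * θ : ℝ) : ℂ) else 0

theorem norm_sawtooth_le (θ : ℝ) : ‖sawtooth θ‖ ≤ 1 := by
  unfold sawtooth
  split_ifs with h
  · rw [Complex.norm_real, Real.norm_eq_abs, abs_le]
    exact ⟨by linarith [h.2], by linarith [h.1]⟩
  · simp

theorem memLp_sawtooth : MemLp sawtooth ∞ unitMeasure := by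
  refine memLp_top_of_bound (Measurable.aestronglyMeasurable ?_) 1
    (Eventually.of_forall norm_sawtooth_le)
  exact Measurable.ite measurableSet_Ioc (by fun_prop) measurable_const

theorem integral_linear_mul_expFun (k : ℤ) :
    ∫ θ, ((1 - 2 * θ : ℝ) : ℂ) * expFun k θ ∂unitMeasure =
      if k = 0 then 0 else 1 / (Complex.I * Real.pi * (-k)) := by
  rw [← intervalIntegral.integral_of_le zero_le_one]
  split_ifs with hk
  · subst hk
    have h : ∀ θ : ℝ, ((1 - 2 * θ : ℝ) : ℂ) * expFun 0 θ = ((1 - 2 * θ : ℝ) : ℂ) := fun θ => by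
      simp [expFun]
    simp_rw [h]
    rw [intervalIntegral.integral_ofReal, intervalIntegral.integral_sub (by simp)
      (Continuous.intervalIntegrable (by fun_prop) _ _),
      intervalIntegral.integral_const_mul, integral_id]
    norm_num
  · set c : ℂ := 2 * Real.pi * Complex.I * k with hc
    have hc0 : c ≠ 0 := exp_coeff_ne_zero hk
    have hd : ∀ θ ∈ Set.uIcc (0 : ℝ) 1, HasDerivAt
        -- The antiderivative obtained by integrating by parts once.
        (fun θ : ℝ => ((1 - 2 * (θ : ℂ)) / c + 2 / c ^ 2) * expFun k θ)
        (((1 - 2 * θ : ℝ) : ℂ) * expFun k θ) θ := by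
      intro θ _
      have h1 : HasDerivAt (fun z : ℂ => ((1 - 2 * z) / c + 2 / c ^ 2) * Complex.exp (c * z))
          ((-2 / c) * Complex.exp (c * θ) +
            ((1 - 2 * θ) / c + 2 / c ^ 2) * (Complex.exp (c * θ) * c)) (θ : ℂ) := by
        have e1 : HasDerivAt (fun z : ℂ => (1 - 2 * z) / c + 2 / c ^ 2) (-2 / c) (θ : ℂ) := by
          have := ((((hasDerivAt_id (θ : ℂ)).const_mul 2).const_sub 1).div_const c).add_const (2 / c ^ 2)
          simpa using this
        have e2 : HasDerivAt (fun z : ℂ => Complex.exp (c * z)) (Complex.exp (c * θ) * c) (θ : ℂ) := by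
          have := ((hasDerivAt_id (θ : ℂ)).const_mul c).cexp
          simpa using this
        exact e1.mul e2
      refine h1.comp_ofReal.congr_deriv ?_
      unfold expFun
      rw [← hc]
      push_cast
      field_simp
      ring
    rw [intervalIntegral.integral_eq_sub_of_hasDerivAt hd
      (Continuous.intervalIntegrable (by have := continuous_expFun k; fun_prop) _ _)]
    have h0 : expFun k 0 = 1 := by simp [expFun]
    rw [expFun_one, h0, hc]
    have hk' : (k : ℂ) ≠ 0 := by exact_mod_cast hk
    have hpi : (Real.pi : ℂ) ≠ 0 := by exact_mod_cast Real.pi_ne_zero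
    have := Complex.I_ne_zero
    push_cast
    field_simp
    ring

theorem inner_expL2_mulOp_sawtooth (m n : ℤ) :
    inner ℂ (expL2 m) (mulOp sawtooth memLp_sawtooth (expL2 n)) =
      if m = n then 0 else 1 / (Complex.I * Real.pi * (m - n)) := by
  rw [L2.inner_def]
  have h : ∫ θ, inner ℂ (expL2 m θ) (mulOp sawtooth memLp_sawtooth (expL2 n) θ) ∂unitMeasure =
      ∫ θ, ((1 - 2 * θ : ℝ) : ℂ) * expFun (n - m) θ ∂unitMeasure := by
    refine integral_congr_ae ?_
    filter_upwards [coeFn_expL2 m, coeFn_expL2 n, coeFn_mulOp sawtooth memLp_sawtooth (expL2 n),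
      ae_restrict_mem measurableSet_Ioc] with θ h1 h2 h3 h4
    rw [h3, h1, h2, RCLike.inner_apply, mul_assoc, expFun_mul_conj, sawtooth, if_pos h4]
  rw [h, integral_linear_mul_expFun]
  simp only [sub_eq_zero, eq_comm (a := n)]
  push_cast
  rw [neg_sub]

end Circle

/-! ### The discretization as a Toeplitz compression; plane waves. -/

section Discrete

variable {a b o : ℝ} {N : ℕ+}

/-- The factor `1 / N` cancels against the meshwidth, so `o` and `N` enter only through the index
set. -/
theorem systemMatrix_apply (m n : gridIndex a b o N) :
    systemMatrix a b o N m n =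
      if (m : ℤ) = n then 0 else 1 / (Complex.I * Real.pi * ((m : ℤ) - (n : ℤ))) := by
  have hN : ((N : ℕ) : ℂ) ≠ 0 := by exact_mod_cast N.pos.ne'
  unfold systemMatrix
  rw [Matrix.of_apply]
  by_cases h : m = n
  · simp [h]
  · have h' : (m : ℤ) ≠ n := fun h' => h (Subtype.ext h')
    rw [if_neg h, if_neg h']
    have h2 : ((gridPoint o N m : ℂ) - (gridPoint o N n : ℂ)) = ((m : ℤ) - (n : ℤ)) / (N : ℕ) := by
      unfold gridPoint
      push_cast
      ring
    have h3 : (((m : ℤ) : ℂ) - ((n : ℤ) : ℂ)) ≠ 0 := by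
      rw [sub_ne_zero]; exact_mod_cast h'
    rw [h2]
    field_simp

theorem isSelfAdjoint_discreteOp : IsSelfAdjoint (discreteOp a b o N) := by
  have h : IsSelfAdjoint (systemMatrix a b o N) := by
    rw [IsSelfAdjoint, Matrix.star_eq_conjTranspose]
    ext m n
    rw [Matrix.conjTranspose_apply, systemMatrix_apply, systemMatrix_apply]
    by_cases h : (m : ℤ) = n
    · simp [h]
    · rw [if_neg h, if_neg (Ne.symm h), RCLike.star_def]
      simp only [map_div₀, map_one, map_mul, map_sub, Complex.conj_I, Complex.conj_ofReal,
        map_intCast]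
      congr 1
      ring
  exact h.map (Matrix.toEuclideanCLM (n := gridIndex a b o N) (𝕜 := ℂ))

/-- The trigonometric polynomial with given coefficients. -/
def trigPoly (u : EuclideanSpace ℂ (gridIndex a b o N)) : Lp ℂ 2 unitMeasure :=
  ∑ n : gridIndex a b o N, u n • expL2 n

theorem orthonormal_expL2_grid :
    Orthonormal ℂ (fun n : gridIndex a b o N => expL2 n) :=
  orthonormal_expL2.comp _ Subtype.val_injective

theorem inner_expL2_trigPoly (u : EuclideanSpace ℂ (gridIndex a b o N)) (m : gridIndex a b o N) :
    inner ℂ (expL2 m) (trigPoly u) = u m :=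
  orthonormal_expL2_grid.inner_right_fintype u m

theorem norm_trigPoly (u : EuclideanSpace ℂ (gridIndex a b o N)) : ‖trigPoly u‖ = ‖u‖ := by
  have h : inner ℂ (trigPoly u) (trigPoly u) = inner ℂ u u := by
    unfold trigPoly
    rw [orthonormal_expL2_grid.inner_sum u u Finset.univ, PiLp.inner_apply]
    refine Finset.sum_congr rfl fun n _ => ?_
    rw [RCLike.inner_apply, mul_comm]
  rw [inner_self_eq_norm_sq_to_K, inner_self_eq_norm_sq_to_K] at h
  have h2 : ‖trigPoly u‖ ^ 2 = ‖u‖ ^ 2 := by exact_mod_cast h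
  exact (pow_left_inj₀ (norm_nonneg _) (norm_nonneg _) two_ne_zero).mp h2

theorem discreteOp_apply (u : EuclideanSpace ℂ (gridIndex a b o N)) (m : gridIndex a b o N) :
    discreteOp a b o N u m =
      inner ℂ (expL2 m) (mulOp sawtooth memLp_sawtooth (trigPoly u)) := by
  have h : discreteOp a b o N u m = ∑ n, systemMatrix a b o N m n * u n := rfl
  rw [h, trigPoly, map_sum, inner_sum]
  refine Finset.sum_congr rfl fun n _ => ?_
  rw [map_smul, inner_smul_right, inner_expL2_mulOp_sawtooth, systemMatrix_apply, mul_comm]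

/-- Bessel's inequality: the left vector consists of the Fourier coefficients, at the frequencies in
`ω^N`, of the function on the right. -/
theorem norm_smul_sub_discreteOp_le (lam : ℂ) (u : EuclideanSpace ℂ (gridIndex a b o N)) :
    ‖lam • u - discreteOp a b o N u‖ ≤
      ‖lam • trigPoly u - mulOp sawtooth memLp_sawtooth (trigPoly u)‖ := by
  rw [← sq_le_sq₀ (norm_nonneg _) (norm_nonneg _), EuclideanSpace.norm_sq_eq]
  refine le_trans (le_of_eq ?_) ((orthonormal_expL2_grid (a := a) (b := b) (o := o)
    (N := N)).sum_inner_products_le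
    (s := Finset.univ) (x := lam • trigPoly u - mulOp sawtooth memLp_sawtooth (trigPoly u)))
  refine Finset.sum_congr rfl fun m _ => ?_
  rw [inner_sub_right, inner_smul_right, inner_expL2_trigPoly, ← discreteOp_apply]
  rfl

theorem norm_discreteOp_apply_le (u : EuclideanSpace ℂ (gridIndex a b o N)) :
    ‖discreteOp a b o N u‖ ≤ ‖u‖ := by
  have h := norm_smul_sub_discreteOp_le 0 u
  rw [zero_smul, zero_sub, norm_neg, zero_smul, zero_sub, norm_neg] at h
  refine h.trans ((norm_mulOp_le _ _ norm_sawtooth_le _).trans ?_)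
  rw [norm_trigPoly]

/-- The first and the last-plus-one index of the grid. -/
theorem mem_gridIndex_iff (m : ℤ) : m ∈ gridIndex a b o N ↔
    m ∈ Finset.Ico (⌊(a - o) * (N : ℕ)⌋ + 1) ⌈(b - o) * (N : ℕ)⌉ := by
  have hN : (0 : ℝ) < (N : ℕ) := by exact_mod_cast N.pos
  rw [Finset.mem_Ico, Int.add_one_le_iff, Int.floor_lt, Int.lt_ceil]
  change o + (m : ℝ) / (N : ℕ) ∈ Set.Ioo a b ↔ _
  rw [Set.mem_Ioo, ← lt_div_iff₀ hN, ← div_lt_iff₀ hN]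
  constructor <;> rintro ⟨h1, h2⟩ <;> constructor <;> linarith

theorem sub_one_mul_sum_zpow {z : ℂ} (hz : z ≠ 0) {p q : ℤ} (hpq : p ≤ q) :
    (z - 1) * ∑ n ∈ Finset.Ico p q, z ^ n = z ^ q - z ^ p := by
  induction q, hpq using Int.leInduction with
  | base => simp
  | succ q hq ih =>
    rw [← Finset.insert_Ico_right_eq_Ico_add_one hq, Finset.sum_insert (by simp), mul_add, ih,
      zpow_add_one₀ hz]
    ring

theorem norm_sub_one_mul_sum_zpow_le {z : ℂ} (hz : ‖z‖ = 1) (p q : ℤ) :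
    ‖z - 1‖ * ‖∑ n ∈ Finset.Ico p q, z ^ n‖ ≤ 2 := by
  rcases le_total p q with h | h
  · have hz0 : z ≠ 0 := by rw [← norm_pos_iff, hz]; exact one_pos
    rw [← norm_mul, sub_one_mul_sum_zpow hz0 h]
    refine (norm_sub_le _ _).trans ?_
    rw [norm_zpow, norm_zpow, hz, one_zpow, one_zpow]
    norm_num
  · rw [Finset.Ico_eq_empty (by omega)]; simp

/-- Jordan's inequality for `|s| ≤ 1/2`, and its reflection `s ↦ 1 - s` beyond; `η` keeps `s` away
from the zeros at `±1`. -/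
theorem two_mul_le_abs_sin {η s : ℝ} (h0 : 0 ≤ η) (h1 : η ≤ 1) (hs : |s| ≤ 1 - η) :
    2 * η * |s| ≤ |Real.sin (Real.pi * s)| := by
  have hpi := Real.pi_pos
  have habs : |Real.sin (Real.pi * s)| = |Real.sin (Real.pi * |s|)| := by
    rcases abs_cases s with ⟨h, _⟩ | ⟨h, _⟩
    · rw [h]
    · rw [h, mul_neg, Real.sin_neg, abs_neg]
  rw [habs]
  have hs0 := abs_nonneg s
  refine le_trans ?_ (le_abs_self _)
  have key : ∀ t : ℝ, 0 ≤ t → t ≤ 1 / 2 → 2 * t ≤ Real.sin (Real.pi * t) := fun t h2 h3 => by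
    have := Real.mul_le_sin (x := Real.pi * t) (by positivity) (by nlinarith)
    refine le_trans (le_of_eq ?_) this
    field_simp
  rcases le_total |s| (1 / 2) with h | h
  · refine le_trans ?_ (key _ hs0 h)
    nlinarith
  · have := key (1 - |s|) (by linarith) (by linarith)
    rw [show Real.pi * (1 - |s|) = Real.pi - Real.pi * |s| by ring, Real.sin_pi_sub] at this
    refine le_trans ?_ this
    nlinarith

theorem sum_gridIndex {M : Type*} [AddCommMonoid M] (g : ℤ → M) :
    ∑ n : gridIndex a b o N, g n =
      ∑ n ∈ Finset.Ico (⌊(a - o) * (N : ℕ)⌋ + 1) ⌈(b - o) * (N : ℕ)⌉, g n :=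
  (Finset.sum_subtype (F := gridIndexFintype a b o N) _
    (fun m => (mem_gridIndex_iff (a := a) (b := b) (o := o) (N := N) m).symm) g).symm

/-- The plane wave on the grid. -/
def planeWave (a b o : ℝ) (N : ℕ+) (θ₀ : ℝ) : EuclideanSpace ℂ (gridIndex a b o N) :=
  WithLp.toLp 2 fun n => expFun n (-θ₀)

theorem coeFn_trigPoly_planeWave (θ₀ : ℝ) :
    trigPoly (planeWave a b o N θ₀) =ᵐ[unitMeasure] fun θ =>
      ∑ n ∈ Finset.Ico (⌊(a - o) * (N : ℕ)⌋ + 1) ⌈(b - o) * (N : ℕ)⌉,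
        (Complex.exp (Complex.I * (2 * Real.pi * (θ - θ₀) : ℝ))) ^ n := by
  have h1 : ∀ᵐ θ ∂unitMeasure, ∀ n : gridIndex a b o N, expL2 n θ = expFun n θ :=
    ae_all_iff.mpr fun n => coeFn_expL2 n
  have h2 : ∀ᵐ θ ∂unitMeasure, ∀ n : gridIndex a b o N,
      (planeWave a b o N θ₀ n • expL2 n) θ = planeWave a b o N θ₀ n • expL2 n θ :=
    ae_all_iff.mpr fun n => Lp.coeFn_smul _ _
  unfold trigPoly
  filter_upwards [h1, h2, Lp.coeFn_fun_finsetSum Finset.univ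
    (fun n : gridIndex a b o N => planeWave a b o N θ₀ n • expL2 n)] with θ h1 h2 h3
  rw [h3, ← sum_gridIndex]
  refine Finset.sum_congr rfl fun n _ => ?_
  rw [h2, h1]
  change expFun n (-θ₀) * expFun n θ = _
  unfold expFun
  rw [← Complex.exp_add, ← Complex.exp_int_mul]
  congr 1
  push_cast
  ring

/-- The symbol satisfies `lam - (1 - 2θ) = 2(θ - θ₀)`, and this zero offsets the growth `1 / |sin
π(θ - θ₀)|` of the Dirichlet kernel, uniformly in `o` and `N`. -/
theorem norm_smul_sub_sawtooth_planeWave_le {lam : ℝ} (hl : lam ∈ Set.Ioo (-1 : ℝ) 1) :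
    ∃ C : ℝ, 0 ≤ C ∧ ∀ o : ℝ, ∀ N : ℕ+,
      ‖(lam : ℂ) • planeWave a b o N ((1 - lam) / 2) -
        discreteOp a b o N (planeWave a b o N ((1 - lam) / 2))‖ ≤ C := by
  set θ₀ : ℝ := (1 - lam) / 2 with hθ
  have h1 : 0 < θ₀ := by linarith [hl.2]
  have h2 : θ₀ < 1 := by linarith [hl.1]
  -- For `θ` in `(0, 1]` one has `|θ - θ₀| ≤ max θ₀ (1 - θ₀) = 1 - η`.
  set η : ℝ := min θ₀ (1 - θ₀) with hη
  have hη0 : 0 < η := lt_min h1 (by linarith)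
  refine ⟨1 / η, by positivity, fun o N => ?_⟩
  refine (norm_smul_sub_discreteOp_le _ _).trans ?_
  set F := trigPoly (planeWave a b o N θ₀) with hF
  have hbound : ∀ᵐ θ ∂unitMeasure,
      ‖((lam : ℂ) • F - mulOp sawtooth memLp_sawtooth F) θ‖ ≤ 1 / η := by
    filter_upwards [coeFn_trigPoly_planeWave (a := a) (b := b) (o := o) (N := N) θ₀,
      Lp.coeFn_sub ((lam : ℂ) • F) (mulOp sawtooth memLp_sawtooth F),
      Lp.coeFn_smul (lam : ℂ) F, coeFn_mulOp sawtooth memLp_sawtooth F,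
      ae_restrict_mem measurableSet_Ioc] with θ e1 e2 e3 e4 hθ1
    rw [e2, Pi.sub_apply, e3, Pi.smul_apply, e4, hF, e1, sawtooth, if_pos hθ1, smul_eq_mul,
      ← sub_mul, ← Complex.ofReal_sub, norm_mul, Complex.norm_real,
      show lam - (1 - 2 * θ) = 2 * (θ - θ₀) by rw [hθ]; ring, Real.norm_eq_abs, abs_mul, abs_two]
    have hz := norm_sub_one_mul_sum_zpow_le (z := Complex.exp (Complex.I * (2 * Real.pi * (θ - θ₀) : ℝ)))
      (by rw [mul_comm]; exact Complex.norm_exp_ofReal_mul_I _)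
      (⌊(a - o) * (N : ℕ)⌋ + 1) ⌈(b - o) * (N : ℕ)⌉
    set S := ‖∑ n ∈ Finset.Ico (⌊(a - o) * (N : ℕ)⌋ + 1) ⌈(b - o) * (N : ℕ)⌉,
        (Complex.exp (Complex.I * (2 * Real.pi * (θ - θ₀) : ℝ))) ^ n‖ with hS
    rw [Complex.norm_exp_I_mul_ofReal_sub_one, Real.norm_eq_abs, abs_mul, abs_two,
      show 2 * Real.pi * (θ - θ₀) / 2 = Real.pi * (θ - θ₀) by ring] at hz
    have hs := two_mul_le_abs_sin (η := η) (s := θ - θ₀) hη0.le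
      ((min_le_left _ _).trans h2.le) (by
        rw [abs_le]
        have m1 := min_le_left θ₀ (1 - θ₀)
        have m2 := min_le_right θ₀ (1 - θ₀)
        constructor <;> linarith [hθ1.1, hθ1.2])
    have hS0 : 0 ≤ S := norm_nonneg _
    rw [le_div_iff₀ hη0]
    have := mul_le_mul_of_nonneg_right hs hS0
    nlinarith
  have := Lp.norm_le_of_ae_bound (by positivity) hbound
  simpa [measureUnivNNReal] using this

theorem norm_planeWave_sq (θ₀ : ℝ) :
    (b - a) * (N : ℕ) - 1 ≤ ‖planeWave a b o N θ₀‖ ^ 2 := by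
  rw [EuclideanSpace.norm_sq_eq]
  have h1 : ∀ n : gridIndex a b o N, ‖planeWave a b o N θ₀ n‖ ^ 2 = 1 := fun n => by
    change ‖expFun n (-θ₀)‖ ^ 2 = 1
    rw [norm_expFun]; norm_num
  simp_rw [h1]
  have h2 : ∑ _n : gridIndex a b o N, (1 : ℝ) =
      ∑ n ∈ Finset.Ico (⌊(a - o) * (N : ℕ)⌋ + 1) ⌈(b - o) * (N : ℕ)⌉, (1 : ℝ) :=
    sum_gridIndex fun _ => (1 : ℝ)
  rw [h2, Finset.sum_const, Int.card_Ico, nsmul_eq_mul, mul_one]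
  have h3 : ((⌈(b - o) * (N : ℕ)⌉ - (⌊(a - o) * (N : ℕ)⌋ + 1) : ℤ) : ℝ) ≤
      (((⌈(b - o) * (N : ℕ)⌉ - (⌊(a - o) * (N : ℕ)⌋ + 1)).toNat : ℕ) : ℝ) := by
    exact_mod_cast Int.self_le_toNat _
  refine le_trans ?_ h3
  push_cast
  have h4 := Int.le_ceil ((b - o) * (N : ℕ))
  have h5 := Int.floor_le ((a - o) * (N : ℕ))
  nlinarith

/-- Every point of `(-1, 1)` is an approximate eigenvalue of the discretization. -/
theorem exists_approx_eigenvector_discreteOp (hab : a < b) (o : ℕ+ → ℝ) {lam : ℝ}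
    (hl : lam ∈ Set.Ioo (-1 : ℝ) 1) {e : ℝ} (he : 0 < e) :
    ∃ N : ℕ+, ∃ u : EuclideanSpace ℂ (gridIndex a b (o N) N), u ≠ 0 ∧
      ‖(lam : ℂ) • u - discreteOp a b (o N) N u‖ ≤ e * ‖u‖ := by
  obtain ⟨C, hC, h⟩ := norm_smul_sub_sawtooth_planeWave_le (a := a) (b := b) hl
  have hba : 0 < b - a := by linarith
  -- The squared norm is at least `(b - a) N - 1`. One unit of the `+ 2` absorbs this `- 1`, the
  -- other ensures a nonzero vector.
  obtain ⟨N, hN⟩ : ∃ N : ℕ+, ((C / e) ^ 2 + 2) / (b - a) < (N : ℕ) := by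
    obtain ⟨n, hn⟩ := exists_nat_gt (((C / e) ^ 2 + 2) / (b - a))
    have hn0 : 0 < n := by
      have : (0 : ℝ) < n := lt_of_le_of_lt (by positivity) hn
      exact_mod_cast this
    exact ⟨⟨n, hn0⟩, hn⟩
  rw [div_lt_iff₀ hba] at hN
  have hbig := norm_planeWave_sq (a := a) (b := b) (o := o N) (N := N) ((1 - lam) / 2)
  refine ⟨N, planeWave a b _ _ ((1 - lam) / 2), ?_, ?_⟩
  · intro h0
    rw [h0, norm_zero] at hbig
    nlinarith [sq_nonneg (C / e)]
  · refine (h _ _).trans ?_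
    have hle : C / e ≤ ‖planeWave a b (o N) N ((1 - lam) / 2)‖ :=
      le_of_sq_le_sq (by linarith) (norm_nonneg _)
    rw [div_le_iff₀ he] at hle
    linarith

end Discrete

/-! ### Resolvents of self-adjoint contractions. -/

section Resolvent

variable {E : Type*} [NormedAddCommGroup E] [InnerProductSpace ℂ E]

/-- Here `t` is the point of `[-1, 1]` nearest to `α`, and `x`, `y` stand for `‖u‖`, `‖T u‖`. The
`max` with 0 covers `|α| ≤ 1`, where `t = α`. -/
theorem exists_nearest_mem_Icc (α : ℝ) : ∃ t ∈ Set.Icc (-1 : ℝ) 1, ∀ x y : ℝ, 0 ≤ x → y ≤ x →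
    |α - t| * x ≤ max 0 (|α| * x - y) := by
  rcases le_total |α| 1 with h | h
  · refine ⟨α, abs_le.mp h, fun x y hx hy => ?_⟩
    rw [sub_self, abs_zero, zero_mul]
    exact le_max_left _ _
  · rcases abs_cases α with ⟨h1, h2⟩ | ⟨h1, h2⟩
    · refine ⟨1, by norm_num, fun x y hx hy => le_trans ?_ (le_max_right _ _)⟩
      rw [h1, abs_of_nonneg (by linarith)]
      nlinarith
    · refine ⟨-1, by norm_num, fun x y hx hy => le_trans ?_ (le_max_right _ _)⟩
      rw [h1, abs_of_nonpos (by linarith)]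
      nlinarith

/-- For a self-adjoint contraction, `lam - T` is bounded below by the distance of `lam` to a
suitable point of `[-1, 1]` that depends on `lam` only. -/
theorem exists_dist_mul_norm_le (lam : ℂ) : ∃ t ∈ Set.Icc (-1 : ℝ) 1,
    ∀ {E : Type} [NormedAddCommGroup E] [InnerProductSpace ℂ E] [CompleteSpace E]
      {T : E →L[ℂ] E}, IsSelfAdjoint T → (∀ u, ‖T u‖ ≤ ‖u‖) → ∀ u,
      ‖lam - t‖ * ‖u‖ ≤ ‖lam • u - T u‖ := by
  obtain ⟨t, ht, h⟩ := exists_nearest_mem_Icc lam.re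
  refine ⟨t, ht, fun {E} _ _ _ {T} hT hle u => ?_⟩
  set w : E := (lam.re : ℂ) • u - T u with hw
  -- Since `⟨w, u⟩` is real, the two summands are orthogonal for the real part of the inner product,
  -- and Pythagoras applies.
  have hdec : lam • u - T u = w + (Complex.I * lam.im) • u := by
    rw [hw]
    nth_rewrite 1 [← Complex.re_add_im lam]
    rw [add_smul, mul_comm (lam.im : ℂ)]
    abel
  have hsym : (inner ℂ (T u) u).im = 0 := by
    have h1 := (ContinuousLinearMap.isSelfAdjoint_iff_isSymmetric.mp hT) u u
    have h2 : starRingEnd ℂ (inner ℂ (T u) u) = inner ℂ (T u) u := by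
      rw [inner_conj_symm]
      exact h1.symm
    exact Complex.conj_eq_iff_im.mp h2
  have hinner : RCLike.re (inner ℂ w ((Complex.I * lam.im) • u)) = 0 := by
    rw [inner_smul_right, hw, inner_sub_left, inner_smul_left, inner_self_eq_norm_sq_to_K]
    have h3 : ((starRingEnd ℂ) (lam.re : ℂ) * ((‖u‖ : ℂ)) ^ 2 - inner ℂ (T u) u).im = 0 := by
      rw [Complex.conj_ofReal, Complex.sub_im, hsym, ← Complex.ofReal_pow, ← Complex.ofReal_mul,
        Complex.ofReal_im, sub_zero]
    have h4 : ∀ z : ℂ, z.im = 0 → (Complex.I * lam.im * z).re = 0 := fun z hz => by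
      rw [mul_assoc, Complex.I_mul_re, Complex.im_ofReal_mul, hz, mul_zero, neg_zero]
    exact h4 _ h3
  have hsq : ‖lam • u - T u‖ ^ 2 = ‖w‖ ^ 2 + lam.im ^ 2 * ‖u‖ ^ 2 := by
    rw [hdec, @norm_add_sq ℂ, hinner, norm_smul, norm_mul, Complex.norm_I, Complex.norm_real,
      Real.norm_eq_abs, one_mul, mul_pow, sq_abs]
    ring
  have hwn : |lam.re - t| * ‖u‖ ≤ ‖w‖ := by
    refine (h ‖u‖ ‖T u‖ (norm_nonneg _) (hle u)).trans (max_le (norm_nonneg _) ?_)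
    have := norm_sub_norm_le ((lam.re : ℂ) • u) (T u)
    rwa [norm_smul, Complex.norm_real, Real.norm_eq_abs] at this
  have hd : ‖lam - t‖ ^ 2 = (lam.re - t) ^ 2 + lam.im ^ 2 := by
    rw [← Complex.normSq_eq_norm_sq, Complex.normSq_apply]
    simp
    ring
  rw [← sq_le_sq₀ (by positivity) (norm_nonneg _), mul_pow, hd, hsq, add_mul]
  have h4 := pow_le_pow_left₀ (by positivity) hwn 2
  rw [mul_pow, sq_abs] at h4
  linarith

theorem isUnit_smul_one_sub [CompleteSpace E] {T : E →L[ℂ] E} (hT : IsSelfAdjoint T) (hle : ∀ u, ‖T u‖ ≤ ‖u‖)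
    {lam : ℂ} (hl : lam ∉ segmentC) : IsUnit (lam • 1 - T) := by
  by_contra hcon
  have hmem : lam ∈ spectrum ℂ T := by
    rw [spectrum.mem_iff, Algebra.algebraMap_eq_smul_one]
    exact hcon
  have hre := hT.mem_spectrum_eq_re hmem
  have hn : ‖lam‖ ≤ 1 := by
    refine (spectrum.norm_le_norm_mul_of_mem hmem).trans ?_
    have h1 : ‖T‖ ≤ 1 := ContinuousLinearMap.opNorm_le_bound _ zero_le_one fun u => by
      rw [one_mul]; exact hle u
    -- An inequality only: the space is zero when `ω^N` is empty.
    have h2 : ‖(1 : E →L[ℂ] E)‖ ≤ 1 := ContinuousLinearMap.norm_id_le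
    calc ‖T‖ * ‖(1 : E →L[ℂ] E)‖ ≤ 1 * 1 := by gcongr
      _ = 1 := one_mul 1
  refine hl ⟨lam.re, ?_, hre.symm⟩
  rw [hre, Complex.norm_real, Real.norm_eq_abs] at hn
  exact abs_le.mp hn

theorem inverse_apply_apply {S : E →L[ℂ] E} (hS : IsUnit S) (u : E) : Ring.inverse S (S u) = u := by
  have := Ring.inverse_mul_cancel S hS
  exact congrArg (fun L : E →L[ℂ] E => L u) this

theorem apply_inverse_apply {S : E →L[ℂ] E} (hS : IsUnit S) (u : E) : S (Ring.inverse S u) = u := by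
  have := Ring.mul_inverse_cancel S hS
  exact congrArg (fun L : E →L[ℂ] E => L u) this

theorem norm_inverse_le {S : E →L[ℂ] E} (hS : IsUnit S) {c : ℝ} (hc : 0 < c)
    (h : ∀ u, c * ‖u‖ ≤ ‖S u‖) : ‖Ring.inverse S‖ ≤ c⁻¹ := by
  refine ContinuousLinearMap.opNorm_le_bound _ (by positivity) fun u => ?_
  have := h (Ring.inverse S u)
  rw [apply_inverse_apply hS] at this
  rw [inv_mul_eq_div, le_div_iff₀ hc]
  linarith

/-- An approximate null vector forces a large inverse: apply the inverse to `S u`. -/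
theorem one_le_norm_inverse_mul {S : E →L[ℂ] E} (hS : IsUnit S) {e : ℝ} {u : E} (hu : u ≠ 0)
    (h : ‖S u‖ ≤ e * ‖u‖) : 1 ≤ ‖Ring.inverse S‖ * e := by
  have h1 := (Ring.inverse S).le_opNorm (S u)
  rw [inverse_apply_apply hS] at h1
  have h2 : 0 < ‖u‖ := norm_pos_iff.mpr hu
  have h3 := mul_le_mul_of_nonneg_left h (norm_nonneg (Ring.inverse S))
  nlinarith

theorem smul_one_sub_apply (lam : ℂ) (T : E →L[ℂ] E) (u : E) :
    (lam • (1 : E →L[ℂ] E) - T) u = lam • u - T u := rfl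

theorem norm_smul_sub_le_of_near {T : E →L[ℂ] E} {lam mu : ℂ} {d e : ℝ} {u : E}
    (h : ‖mu • u - T u‖ ≤ e * ‖u‖) (hd : ‖lam - mu‖ ≤ d) :
    ‖lam • u - T u‖ ≤ (d + e) * ‖u‖ := by
  have h1 : lam • u - T u = (lam - mu) • u + (mu • u - T u) := by
    rw [sub_smul]; abel
  rw [h1, add_mul]
  refine (norm_add_le _ _).trans (add_le_add ?_ h)
  rw [norm_smul]
  gcongr

theorem exists_near_mem_Ioo {t : ℝ} (ht : t ∈ Set.Icc (-1 : ℝ) 1) {e : ℝ} (he : 0 < e) :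
    ∃ s ∈ Set.Ioo (-1 : ℝ) 1, ‖(t : ℂ) - s‖ ≤ e := by
  set r := min e 1 with hr
  have hr0 : 0 < r := lt_min he one_pos
  have hr1 : r ≤ 1 := min_le_right _ _
  have ht' := abs_le.mpr ht
  have habs : |(1 - r) * t| < 1 := by
    rw [abs_mul, abs_of_nonneg (by linarith)]
    nlinarith [abs_nonneg t]
  refine ⟨(1 - r) * t, abs_lt.mp habs, ?_⟩
  rw [← Complex.ofReal_sub, Complex.norm_real, Real.norm_eq_abs,
    show t - (1 - r) * t = r * t by ring, abs_mul, abs_of_pos hr0]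
  have := min_le_left e 1
  nlinarith [abs_nonneg t]

end Resolvent

/-! ### The equivalences and the comparison of resolvents. -/

section Equivalence

variable {a b : ℝ}

theorem solvesSIE_iff (lam : ℂ) (u f : L2 a b) :
    SolvesSIE a b lam u f ↔ (lam • 1 - finiteH a b) u = f := by
  have hH := isFiniteHilbertTransform_finiteH u
  rw [smul_one_sub_apply]
  constructor
  · intro h
    apply Lp.ext
    filter_upwards [h, hH, Lp.coeFn_sub (lam • u) (finiteH a b u), Lp.coeFn_smul lam u]
      with x ⟨l, h1, h2⟩ h3 h4 h5
    rw [h4, Pi.sub_apply, h5, Pi.smul_apply, smul_eq_mul, ← h2, tendsto_nhds_unique h1 h3]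
  · intro h
    subst h
    filter_upwards [hH, Lp.coeFn_sub (lam • u) (finiteH a b u), Lp.coeFn_smul lam u]
      with x h3 h4 h5
    refine ⟨_, h3, ?_⟩
    rw [h4, Pi.sub_apply, h5, Pi.smul_apply, smul_eq_mul]

/-- Unique solvability is bijectivity, and a bijective bounded operator between Banach spaces has a
bounded inverse. -/
theorem uniquelySolvable_iff (lam : ℂ) :
    UniquelySolvable a b lam ↔ IsUnit (lam • 1 - finiteH a b) := by
  rw [ContinuousLinearMap.isUnit_iff_bijective, Function.bijective_iff_existsUnique]
  unfold UniquelySolvable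
  simp only [solvesSIE_iff]

theorem exists_approx_finiteH_of_mem_Icc (hab : a < b) {t : ℝ} (ht : t ∈ Set.Icc (-1 : ℝ) 1)
    {e : ℝ} (he : 0 < e) :
    ∃ u : L2 a b, u ≠ 0 ∧ ‖(t : ℂ) • u - finiteH a b u‖ ≤ e * ‖u‖ := by
  obtain ⟨s, hs, hst⟩ := exists_near_mem_Ioo ht (half_pos he)
  obtain ⟨u, hu, h⟩ := exists_approx_eigenvector_finiteH hab hs (half_pos he)
  refine ⟨u, hu, ?_⟩
  have := norm_smul_sub_le_of_near h hst
  rwa [add_halves] at this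

theorem exists_approx_discreteOp_of_mem_Icc (hab : a < b) (o : ℕ+ → ℝ) {t : ℝ}
    (ht : t ∈ Set.Icc (-1 : ℝ) 1) {e : ℝ} (he : 0 < e) :
    ∃ N : ℕ+, ∃ u : EuclideanSpace ℂ (gridIndex a b (o N) N), u ≠ 0 ∧
      ‖(t : ℂ) • u - discreteOp a b (o N) N u‖ ≤ e * ‖u‖ := by
  obtain ⟨s, hs, hst⟩ := exists_near_mem_Ioo ht (half_pos he)
  obtain ⟨N, u, hu, h⟩ := exists_approx_eigenvector_discreteOp hab o hs (half_pos he)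
  refine ⟨N, u, hu, ?_⟩
  have := norm_smul_sub_le_of_near h hst
  rwa [add_halves] at this

theorem notMem_segmentC_of_isUnit (hab : a < b) {lam : ℂ} (h : IsUnit (lam • 1 - finiteH a b)) :
    lam ∉ segmentC := by
  rintro ⟨t, ht, rfl⟩
  set B := ‖Ring.inverse ((t : ℂ) • 1 - finiteH a b)‖
  have hB : 0 ≤ B := norm_nonneg _
  -- The accuracy is chosen so that its product with `B` is below 1, against the lower bound for the
  -- inverse.
  obtain ⟨u, hu, hle⟩ := exists_approx_finiteH_of_mem_Icc hab ht
    (show 0 < (2 * (B + 1))⁻¹ by positivity)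
  have := one_le_norm_inverse_mul h hu hle
  rw [← div_eq_mul_inv, le_div_iff₀ (by positivity)] at this
  linarith

theorem notMem_segmentC_of_isStable (hab : a < b) {o : ℕ+ → ℝ} {lam : ℂ}
    (h : IsStable a b o lam) : lam ∉ segmentC := by
  rintro ⟨t, ht, rfl⟩
  obtain ⟨C, hC⟩ := h
  have hC0 : 0 ≤ C := (norm_nonneg _).trans (hC 1).2
  have hpos : 0 < (2 * (C + 1))⁻¹ := by positivity
  obtain ⟨N, u, hu, hle⟩ := exists_approx_discreteOp_of_mem_Icc hab o ht hpos
  have h1 := one_le_norm_inverse_mul (hC N).1 hu hle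
  have h2 := mul_le_mul_of_nonneg_right (hC N).2 hpos.le
  have h3 : 1 ≤ C * (2 * (C + 1))⁻¹ := h1.trans h2
  rw [← div_eq_mul_inv, le_div_iff₀ (by positivity)] at h3
  linarith

/-- Both norms are compared with `1 / ‖lam - t‖` for the same `t`: the self-adjoint lower bound puts
the discrete inverse below it, and approximate eigenvectors of `finiteH` at `t` put the continuous
inverse above it. -/
theorem norm_inverse_discreteOp_le (hab : a < b) (o : ℝ) (N : ℕ+) {lam : ℂ}
    (hl : lam ∉ segmentC) :
    ‖Ring.inverse (lam • 1 - discreteOp a b o N)‖ ≤ ‖Ring.inverse (lam • 1 - finiteH a b)‖ := by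
  obtain ⟨t, ht, hdist⟩ := exists_dist_mul_norm_le lam
  have hd : 0 < ‖lam - t‖ := by
    rw [norm_pos_iff, sub_ne_zero]
    rintro rfl
    exact hl ⟨t, ht, rfl⟩
  have hA := isUnit_smul_one_sub (isSelfAdjoint_finiteH (a := a) (b := b)) norm_finiteH_apply_le hl
  have hT := isUnit_smul_one_sub (isSelfAdjoint_discreteOp (a := a) (b := b) (o := o) (N := N))
    norm_discreteOp_apply_le hl
  refine (norm_inverse_le hT hd (hdist isSelfAdjoint_discreteOp norm_discreteOp_apply_le)).trans ?_
  set B := ‖Ring.inverse (lam • 1 - finiteH a b)‖ with hB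
  have hB0 : 0 ≤ B := norm_nonneg _
  rw [inv_le_iff_one_le_mul₀ hd]
  refine le_of_forall_pos_le_add fun e he => ?_
  obtain ⟨u, hu, hle⟩ := exists_approx_finiteH_of_mem_Icc hab ht
    (show 0 < e / (B + 1) by positivity)
  have h1 := one_le_norm_inverse_mul hA hu (norm_smul_sub_le_of_near hle le_rfl)
  rw [← hB, mul_add] at h1
  have h2 : B * (e / (B + 1)) ≤ e := by
    rw [← mul_div_assoc, div_le_iff₀ (by positivity)]
    nlinarith
  linarith

end Equivalence

end FiniteHilbert

end

theorem theoremT (a b : ℝ) (hab : a < b) (o : ℕ+ → ℝ) :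
    ∃ A : FiniteHilbert.L2 a b →L[ℂ] FiniteHilbert.L2 a b,
      FiniteHilbert.IsFiniteHilbertTransform a b A ∧
      ∀ lam : ℂ,
        [FiniteHilbert.UniquelySolvable a b lam,
          FiniteHilbert.IsStable a b o lam,
          lam ∉ FiniteHilbert.segmentC].TFAE ∧
        (lam ∉ FiniteHilbert.segmentC →
          IsUnit (lam • 1 - A) ∧
          ∀ N : ℕ+,
            IsUnit (lam • 1 - FiniteHilbert.discreteOp a b (o N) N) ∧
            ‖Ring.inverse (lam • 1 - FiniteHilbert.discreteOp a b (o N) N)‖ ≤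
              ‖Ring.inverse (lam • 1 - A)‖) := by
  refine ⟨FiniteHilbert.finiteH a b, FiniteHilbert.isFiniteHilbertTransform_finiteH,
    fun lam => ?_⟩
  have hA : lam ∉ FiniteHilbert.segmentC → IsUnit (lam • 1 - FiniteHilbert.finiteH a b) :=
    FiniteHilbert.isUnit_smul_one_sub FiniteHilbert.isSelfAdjoint_finiteH
      FiniteHilbert.norm_finiteH_apply_le
  have hT : lam ∉ FiniteHilbert.segmentC → ∀ N : ℕ+,
      IsUnit (lam • 1 - FiniteHilbert.discreteOp a b (o N) N) ∧
      ‖Ring.inverse (lam • 1 - FiniteHilbert.discreteOp a b (o N) N)‖ ≤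
        ‖Ring.inverse (lam • 1 - FiniteHilbert.finiteH a b)‖ := fun hl N =>
    ⟨FiniteHilbert.isUnit_smul_one_sub FiniteHilbert.isSelfAdjoint_discreteOp
      FiniteHilbert.norm_discreteOp_apply_le hl,
      FiniteHilbert.norm_inverse_discreteOp_le hab (o N) N hl⟩
  refine ⟨?_, fun hl => ⟨hA hl, hT hl⟩⟩
  tfae_have 1 → 3 := fun h =>
    FiniteHilbert.notMem_segmentC_of_isUnit hab ((FiniteHilbert.uniquelySolvable_iff lam).mp h)
  tfae_have 3 → 1 := fun h => (FiniteHilbert.uniquelySolvable_iff lam).mpr (hA h)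
  tfae_have 2 → 3 := FiniteHilbert.notMem_segmentC_of_isStable hab
  tfae_have 3 → 2 := fun h => ⟨_, hT h⟩
  tfae_finish
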